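/- Let $N\ge 3$. Let $C(S^{N-1,1}_{\mathbb R,*})$ be the universal unital $C^*$-algebra generated by self-adjoint elements $x_1,\dots,x_N$ subject to $\sum_i x_i^2=1$, to $x_ix_jx_k=x_kx_jx_i$ for all $i,j,k$, and to $x_ix_jx_k=0$ for $i,j,k$ distinct (the polygonal half-liberated sphere). Let $O_N^+$ be the free orthogonal quantum group: $C(O_N^+)$ is the universal unital $C^*$-algebra generated by self-adjoint elements $u_{ij}$, $1\le i,j\le N$, such that $u=(u_{ij})$ is orthogonal, $uu^t=u^tu=1$. Let $H_N^{[\infty]}\subset O_N^+$ be given by the quotient of $C(O_N^+)$, as a $C^*$-algebra, by the relations $abc=0$ for all entries $a,b,c$ of $u$ such that $a,c$ are distinct entries lying on the same row or on the same column of $u$. A closed subgroup $G\subset O_N^+$ is a compact matrix quantum group $(C(G),u)$ in the sense of Woronowicz, together with a morphism $C(O_N^+)\to C(G)$ mapping standard coordinates to standard coordinates. It acts affinely on $S^{N-1,1}_{\mathbb R,*}$ if there is a morphism of $C^*$-algebras $\Phi:C(S^{N-1,1}_{\mathbb R,*})\to C(G)\otimes C(S^{N-1,1}_{\mathbb R,*})$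 with $\Phi(x_i)=\sum_j u_{ij}\otimes x_j$, where $\otimes$ is the minimal tensor product. The quantum isometry group $G^+(S^{N-1,1}_{\mathbb R,*})$ is the universal (largest) closed subgroup of $O_N^+$ acting affinely on $S^{N-1,1}_{\mathbb R,*}$. Then $G^+(S^{N-1,1}_{\mathbb R,*})=H_N^{[\infty]}$. That is, $H_N^{[\infty]}$ is a closed subgroup of $O_N^+$, it acts affinely on $S^{N-1,1}_{\mathbb R,*}$, and for every closed subgroup $G\subset O_N^+$ acting affinely on $S^{N-1,1}_{\mathbb R,*}$ there is a morphism $C(H_N^{[\infty]})\to C(G)$ mapping standard coordinates to standard coordinates, i.e. $G\subset H_N^{[\infty]}$. -/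

import Mathlib

open scoped TensorProduct

universe v w z

noncomputable section


/-! ### C⋆-seminorms on ⋆-algebras, and the C⋆-algebras they define -/

/-- A C⋆-seminorm on a complex ⋆-algebra. -/
structure CStarSeminorm (F : Type*) [Ring F] [StarRing F] [Algebra ℂ F] extends Seminorm ℂ F where
  mul_le' : ∀ a b : F, toFun (a * b) ≤ toFun a * toFun b
  star_mul_self' : ∀ a : F, toFun (star a * a) = toFun a * toFun a

namespace CStarSeminorm

variable {F : Type*} [Ring F] [StarRing F] [Algebra ℂ F]

instance : FunLike (CStarSeminorm F) F ℝ where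
  coe p := p.toFun
  coe_injective p q h := by
    cases p; cases q; congr; exact DFunLike.coe_injective h

theorem mul_le (p : CStarSeminorm F) (a b : F) : p (a * b) ≤ p a * p b := p.mul_le' a b

theorem star_mul_self (p : CStarSeminorm F) (a : F) : p (star a * a) = p a * p a :=
  p.star_mul_self' a

theorem nonneg (p : CStarSeminorm F) (a : F) : 0 ≤ p a := apply_nonneg p.toSeminorm a

theorem add_le (p : CStarSeminorm F) (a b : F) : p (a + b) ≤ p a + p b :=
  map_add_le_add p.toSeminorm a b

theorem smul_eq (p : CStarSeminorm F) (c : ℂ) (a : F) : p (c • a) = ‖c‖ * p a :=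
  map_smul_eq_mul p.toSeminorm c a

theorem le_star (p : CStarSeminorm F) (a : F) : p a ≤ p (star a) := by
  rcases (p.nonneg a).eq_or_lt with h | h
  · rw [← h]; exact p.nonneg _
  · have h1 := p.mul_le (star a) a
    rw [p.star_mul_self] at h1
    exact le_of_mul_le_mul_right h1 h

theorem star_eq (p : CStarSeminorm F) (a : F) : p (star a) = p a :=
  le_antisymm (by simpa using p.le_star (star a)) (p.le_star a)

/-- The ⋆-algebra `F`, regarded as a seminormed algebra with seminorm `p`. -/
def Carrier (_ : CStarSeminorm F) : Type _ := F

variable (p : CStarSeminorm F)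

instance : Ring p.Carrier := inferInstanceAs (Ring F)
instance : StarRing p.Carrier := inferInstanceAs (StarRing F)
instance : Algebra ℂ p.Carrier := inferInstanceAs (Algebra ℂ F)
instance [StarModule ℂ F] : StarModule ℂ p.Carrier := inferInstanceAs (StarModule ℂ F)

instance : SeminormedAddCommGroup p.Carrier :=
  AddGroupSeminorm.toSeminormedAddCommGroup (E := p.Carrier) p.toSeminorm.toAddGroupSeminorm

instance : SeminormedRing p.Carrier where
  __ := (inferInstance : SeminormedAddCommGroup p.Carrier)
  __ := (inferInstance : Ring p.Carrier)
  norm_mul_le a b := p.mul_le a b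

instance : NormedAlgebra ℂ p.Carrier where
  norm_smul_le c a := (p.smul_eq c a).le

instance : NormedStarGroup p.Carrier where
  norm_star_le a := (p.star_eq a).le

theorem norm_eq (a : p.Carrier) : ‖a‖ = p a := rfl

/-- The Hausdorff completion of the ⋆-algebra `F` with respect to the C⋆-seminorm `p`. -/
abbrev Completion : Type _ := UniformSpace.Completion p.Carrier

theorem uniformContinuous_star : UniformContinuous (star : p.Carrier → p.Carrier) :=
  star_isometry.uniformContinuous

/-- The involution of the completion extends the involution of `F` by continuity. -/
instance : Star p.Completion where
  star := UniformSpace.Completion.map (star : p.Carrier → p.Carrier)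

theorem coe_star (a : p.Carrier) : ((star a : p.Carrier) : p.Completion) = star (a : p.Completion) :=
  (UniformSpace.Completion.map_coe p.uniformContinuous_star a).symm

theorem continuous_star_completion : Continuous (star : p.Completion → p.Completion) :=
  UniformSpace.Completion.continuous_map

instance : StarRing p.Completion where
  star_involutive x := by
    have hm := p.continuous_star_completion
    refine UniformSpace.Completion.induction_on x ?_ fun a => ?_
    · exact isClosed_eq (hm.comp hm) continuous_id
    · rw [← coe_star, ← coe_star, star_star]
  star_mul x y := by
    have hm := p.continuous_star_completion
    refine UniformSpace.Completion.induction_on₂ x y ?_ fun a b => ?_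
    · exact isClosed_eq (hm.comp continuous_mul)
        ((hm.comp continuous_snd).mul (hm.comp continuous_fst))
    · rw [← UniformSpace.Completion.coe_mul, ← coe_star, ← coe_star, ← coe_star,
        ← UniformSpace.Completion.coe_mul, star_mul]
  star_add x y := by
    have hm := p.continuous_star_completion
    refine UniformSpace.Completion.induction_on₂ x y ?_ fun a b => ?_
    · exact isClosed_eq (hm.comp continuous_add)
        ((hm.comp continuous_fst).add (hm.comp continuous_snd))
    · rw [← UniformSpace.Completion.coe_add, ← coe_star, ← coe_star, ← coe_star,
        ← UniformSpace.Completion.coe_add, star_add]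

instance [StarModule ℂ F] : CStarAlgebra p.Completion where
  norm_smul_le := norm_smul_le
  norm_mul_self_le x := by
    have hm := p.continuous_star_completion
    refine UniformSpace.Completion.induction_on x ?_ fun a => ?_
    · exact isClosed_le (continuous_norm.mul continuous_norm)
        (continuous_norm.comp (hm.mul continuous_id))
    · rw [← coe_star, ← UniformSpace.Completion.coe_mul, UniformSpace.Completion.norm_coe,
        UniformSpace.Completion.norm_coe]
      exact (p.star_mul_self a).ge
  star_smul c x := by
    have hm := p.continuous_star_completion
    refine UniformSpace.Completion.induction_on x ?_ fun a => ?_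
    · exact isClosed_eq (hm.comp (continuous_const_smul c)) (hm.const_smul (star c))
    · rw [← UniformSpace.Completion.coe_smul, ← coe_star, ← coe_star,
        ← UniformSpace.Completion.coe_smul, star_smul]

/-- The canonical map from `F` to its completion. -/
def toCompletion : F →ₐ[ℂ] p.Completion where
  toFun a := ((show p.Carrier from a : p.Carrier) : p.Completion)
  map_one' := rfl
  map_mul' a b := UniformSpace.Completion.coe_mul (α := p.Carrier) a b
  map_zero' := rfl
  map_add' a b := UniformSpace.Completion.coe_add (α := p.Carrier) a b
  commutes' _ := rfl

theorem norm_toCompletion (a : F) : ‖p.toCompletion a‖ = p a :=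
  UniformSpace.Completion.norm_coe (E := p.Carrier) a

theorem toCompletion_star (a : F) : p.toCompletion (star a) = star (p.toCompletion a) :=
  p.coe_star a

/-- The pointwise supremum of a pointwise bounded family of C⋆-seminorms. -/
def sup (S : Set (CStarSeminorm F)) (hS : ∀ a, BddAbove (Set.range fun q : S => q.1 a)) :
    CStarSeminorm F :=
  have hle (a : F) (q : S) : q.1 a ≤ ⨆ q : S, q.1 a := le_ciSup (hS a) q
  have h0 (a : F) : 0 ≤ ⨆ q : S, q.1 a := Real.iSup_nonneg fun q => q.1.nonneg a
  { toFun := fun a => ⨆ q : S, q.1 a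
    map_zero' := by
      have h (q : S) : q.1 (0 : F) = 0 := map_zero q.1.toSeminorm
      simp [h]
    add_le' := fun a b => Real.iSup_le (fun q => (q.1.add_le a b).trans
      (add_le_add (hle a q) (hle b q))) (add_nonneg (h0 a) (h0 b))
    neg' := fun a => by
      have h (q : S) : q.1 (-a) = q.1 a := map_neg_eq_map q.1.toSeminorm a
      simp only [h]
    smul' := fun c a => by
      simp only [smul_eq]
      exact (Real.mul_iSup_of_nonneg (norm_nonneg c) _).symm
    mul_le' := fun a b => Real.iSup_le (fun q => (q.1.mul_le a b).trans
      (mul_le_mul (hle a q) (hle b q) (q.1.nonneg b) (h0 a))) (mul_nonneg (h0 a) (h0 b))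
    star_mul_self' := fun a => by
      apply le_antisymm
      · refine Real.iSup_le (fun q => ?_) (mul_nonneg (h0 a) (h0 a))
        rw [star_mul_self]
        exact mul_le_mul (hle a q) (hle a q) (q.1.nonneg a) (h0 a)
      · have h1 : (⨆ q : S, q.1 a) ≤ √(⨆ q : S, q.1 (star a * a)) := by
          refine Real.iSup_le (fun q => Real.le_sqrt_of_sq_le ?_) (Real.sqrt_nonneg _)
          rw [pow_two, ← star_mul_self]
          exact hle _ q
        calc (⨆ q : S, q.1 a) * (⨆ q : S, q.1 a)
            ≤ √(⨆ q : S, q.1 (star a * a)) * √(⨆ q : S, q.1 (star a * a)) :=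
              mul_le_mul h1 h1 (h0 a) (Real.sqrt_nonneg _)
          _ = _ := Real.mul_self_sqrt (h0 _) }

end CStarSeminorm

/-! ### Universal C⋆-algebras on self-adjoint generators -/

/-- The free complex ⋆-algebra on self-adjoint generators indexed by `ι`: noncommutative
polynomials, with basis the words in `ι`. -/
def FreeStarAlg (ι : Type*) : Type _ := MonoidAlgebra ℂ (FreeMonoid ι)

namespace FreeStarAlg

variable {ι : Type*}

instance : Ring (FreeStarAlg ι) := inferInstanceAs (Ring (MonoidAlgebra ℂ (FreeMonoid ι)))
instance : Algebra ℂ (FreeStarAlg ι) :=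
  inferInstanceAs (Algebra ℂ (MonoidAlgebra ℂ (FreeMonoid ι)))

/-- The generator with index `i`. -/
def X (i : ι) : FreeStarAlg ι := MonoidAlgebra.of ℂ (FreeMonoid ι) (FreeMonoid.of i)

/-- The monomial `c • w`. -/
def monomial (w : FreeMonoid ι) (c : ℂ) : FreeStarAlg ι := MonoidAlgebra.single w c

@[elab_as_elim]
theorem induction {P : FreeStarAlg ι → Prop} (f : FreeStarAlg ι) (h0 : P 0)
    (ha : ∀ f g, P f → P g → P (f + g)) (hs : ∀ w c, P (monomial w c)) : P f :=
  MonoidAlgebra.induction_linear (motive := P) f h0 ha hs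

/-- Words are reversed and coefficients conjugated. -/
instance : Star (FreeStarAlg ι) where
  star f := MonoidAlgebra.mapDomain (star : FreeMonoid ι → FreeMonoid ι)
    (MonoidAlgebra.mapRingHom (FreeMonoid ι) (starRingEnd ℂ) f)

theorem star_monomial (w : FreeMonoid ι) (c : ℂ) :
    star (monomial w c) = monomial (star w) (star c) := by
  change MonoidAlgebra.mapDomain _ (MonoidAlgebra.mapRingHom _ _ (MonoidAlgebra.single w c)) = _
  simp [monomial]

theorem monomial_mul (w w' : FreeMonoid ι) (c c' : ℂ) :
    monomial w c * monomial w' c' = monomial (w * w') (c * c') :=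
  MonoidAlgebra.single_mul_single ..

theorem smul_monomial (w : FreeMonoid ι) (c c' : ℂ) :
    c • monomial w c' = monomial w (c * c') :=
  MonoidAlgebra.smul_single ..

protected theorem star_add' (f g : FreeStarAlg ι) : star (f + g) = star f + star g := by
  have h (f g : MonoidAlgebra ℂ (FreeMonoid ι)) :
      MonoidAlgebra.mapDomain (star : FreeMonoid ι → FreeMonoid ι)
        (MonoidAlgebra.mapRingHom (FreeMonoid ι) (starRingEnd ℂ) (f + g)) =
      MonoidAlgebra.mapDomain (star : FreeMonoid ι → FreeMonoid ι)
        (MonoidAlgebra.mapRingHom (FreeMonoid ι) (starRingEnd ℂ) f) +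
      MonoidAlgebra.mapDomain (star : FreeMonoid ι → FreeMonoid ι)
        (MonoidAlgebra.mapRingHom (FreeMonoid ι) (starRingEnd ℂ) g) := by
    rw [map_add, MonoidAlgebra.mapDomain_add]
  exact h f g

protected theorem star_zero' : star (0 : FreeStarAlg ι) = 0 := by
  simpa using FreeStarAlg.star_add' (0 : FreeStarAlg ι) 0

instance : StarRing (FreeStarAlg ι) where
  star_involutive f := by
    refine induction f ?_ (fun f g hf hg => ?_) fun w c => ?_
    · simp only [FreeStarAlg.star_zero']
    · rw [FreeStarAlg.star_add', FreeStarAlg.star_add', hf, hg]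
    · simp only [star_monomial, star_star]
  star_mul f g := by
    refine induction f ?_ (fun f f' hf hf' => ?_) fun w c => ?_
    · simp only [FreeStarAlg.star_zero', zero_mul, mul_zero]
    · rw [add_mul, FreeStarAlg.star_add', FreeStarAlg.star_add', hf, hf', mul_add]
    · refine induction g ?_ (fun g g' hg hg' => ?_) fun w' c' => ?_
      · simp only [FreeStarAlg.star_zero', zero_mul, mul_zero]
      · rw [mul_add, FreeStarAlg.star_add', FreeStarAlg.star_add', hg, hg', add_mul]
      · simp only [star_monomial, monomial_mul, star_mul]
  star_add := FreeStarAlg.star_add'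

instance : StarModule ℂ (FreeStarAlg ι) where
  star_smul c f := by
    refine induction f ?_ (fun f g hf hg => ?_) fun w c' => ?_
    · simp only [smul_zero, star_zero]
    · rw [smul_add, star_add, hf, hg, star_add, smul_add]
    · simp only [smul_monomial, star_monomial, star_mul']

theorem star_X (i : ι) : star (X i) = X i := by
  change star (monomial (FreeMonoid.of i) 1) = monomial (FreeMonoid.of i) 1
  rw [star_monomial, FreeMonoid.star_of, star_one]

/-- The C⋆-seminorms on the free ⋆-algebra which vanish on a set `R` of relators. -/
def relSeminorms (R : Set (FreeStarAlg ι)) : Set (CStarSeminorm (FreeStarAlg ι)) :=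
  {p | ∀ r ∈ R, p r = 0}

/-- The relations `R = 0` bound the norms of the generators; this is the condition under which
a universal C⋆-algebra with these relations exists. -/
def Bounded (R : Set (FreeStarAlg ι)) : Prop :=
  ∀ i, ∃ C, ∀ p ∈ relSeminorms R, p (X i) ≤ C

theorem Bounded.bddAbove {R : Set (FreeStarAlg ι)} (hR : Bounded R) (f : FreeStarAlg ι) :
    BddAbove (Set.range fun q : relSeminorms R => q.1 f) := by
  have key : ∃ C, ∀ p ∈ relSeminorms R, p f ≤ C := by
    refine induction f ⟨0, fun p _ => (map_zero p.toSeminorm).le⟩ (fun f g hf hg => ?_)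
      fun w c => ?_
    · obtain ⟨C, hC⟩ := hf
      obtain ⟨D, hD⟩ := hg
      exact ⟨C + D, fun p hp => (p.add_le f g).trans (add_le_add (hC p hp) (hD p hp))⟩
    · induction w using FreeMonoid.inductionOn' generalizing c with
      | one =>
        refine ⟨‖c‖, fun p _ => ?_⟩
        have h1 : p (1 : FreeStarAlg ι) ≤ 1 := by
          have h := p.star_mul_self 1
          rw [star_one, one_mul] at h
          nlinarith [p.nonneg 1]
        have h2 : monomial (1 : FreeMonoid ι) c = c • (1 : FreeStarAlg ι) := by
          change monomial (1 : FreeMonoid ι) c = c • monomial (1 : FreeMonoid ι) 1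
          rw [smul_monomial, mul_one]
        rw [h2, p.smul_eq]
        exact mul_le_of_le_one_right (norm_nonneg c) h1
      | of_mul i w ih =>
        obtain ⟨C, hC⟩ := hR i
        obtain ⟨D, hD⟩ := ih c
        refine ⟨C * D, fun p hp => ?_⟩
        have h2 : monomial (FreeMonoid.of i * w) c = X i * monomial w c := by
          change _ = monomial (FreeMonoid.of i) 1 * monomial w c
          rw [monomial_mul, one_mul]
        rw [h2]
        exact (p.mul_le _ _).trans (mul_le_mul (hC p hp) (hD p hp) (p.nonneg _)
          ((p.nonneg _).trans (hC p hp)))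
  obtain ⟨C, hC⟩ := key
  exact ⟨C, by rintro _ ⟨q, rfl⟩; exact hC q.1 q.2⟩

/-- Generators occurring in a relation `∑ j, X (g j) ^ 2 = 1` are contractions. -/
theorem le_one_of_sum_sq {κ : Type*} [Fintype κ] (p : CStarSeminorm (FreeStarAlg ι)) (g : κ → ι)
    (h : p ((∑ j, X (g j) * X (g j)) - 1) = 0) (j : κ) : p (X (g j)) ≤ 1 := by
  let _ : PartialOrder p.Completion := CStarAlgebra.spectralOrder _
  let _ : StarOrderedRing p.Completion := CStarAlgebra.spectralOrderedRing _
  have h1 : ∑ j, p.toCompletion (X (g j)) * p.toCompletion (X (g j)) = 1 := by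
    rw [← p.norm_toCompletion, norm_eq_zero, map_sub, map_one, sub_eq_zero, map_sum] at h
    simpa using h
  have hpos (k : κ) : 0 ≤ p.toCompletion (X (g k)) * p.toCompletion (X (g k)) := by
    have := star_mul_self_nonneg (p.toCompletion (X (g k)))
    rwa [← p.toCompletion_star, star_X] at this
  have h2 : p.toCompletion (X (g j)) * p.toCompletion (X (g j)) ≤ 1 := by
    rw [← h1]
    exact Finset.single_le_sum (fun k _ => hpos k) (Finset.mem_univ j)
  have h3 := (CStarAlgebra.norm_le_one_iff_of_nonneg _ (hpos j)).2 h2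
  rw [← map_mul, p.norm_toCompletion] at h3
  nth_rewrite 1 [← star_X] at h3
  rw [p.star_mul_self] at h3
  nlinarith [p.nonneg (X (g j))]

end FreeStarAlg

/-- The universal C⋆-algebra generated by self-adjoint elements indexed by `ι`, subject to the
relations `r = 0` for `r ∈ R`: the completion of the free ⋆-algebra for the largest C⋆-seminorm
vanishing on `R`. -/
abbrev UniversalCStar {ι : Type*} (R : Set (FreeStarAlg ι)) (hR : FreeStarAlg.Bounded R) : Type _ :=
  (CStarSeminorm.sup (FreeStarAlg.relSeminorms R) hR.bddAbove).Completion

/-- The standard generators of a universal C⋆-algebra. -/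
def UniversalCStar.gen {ι : Type*} (R : Set (FreeStarAlg ι)) (hR : FreeStarAlg.Bounded R) (i : ι) :
    UniversalCStar R hR :=
  (CStarSeminorm.sup (FreeStarAlg.relSeminorms R) hR.bddAbove).toCompletion (FreeStarAlg.X i)

/-! ### The spatial (minimal) tensor product of C⋆-algebras -/

section Spatial

variable {H K : Type*} [NormedAddCommGroup H] [InnerProductSpace ℂ H]
  [NormedAddCommGroup K] [InnerProductSpace ℂ K]

/-- The algebraic tensor product of two Hilbert spaces, as a pre-Hilbert space with
`⟪x ⊗ y, x' ⊗ y'⟫ = ⟪x, x'⟫ * ⟪y, y'⟫`; it is dense in the Hilbert space tensor product. -/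
def PreTensor (H K : Type*) [NormedAddCommGroup H] [InnerProductSpace ℂ H]
    [NormedAddCommGroup K] [InnerProductSpace ℂ K] : Type _ := H ⊗[ℂ] K

instance : NormedAddCommGroup (PreTensor H K) :=
  inferInstanceAs (NormedAddCommGroup (H ⊗[ℂ] K))

instance : InnerProductSpace ℂ (PreTensor H K) :=
  inferInstanceAs (InnerProductSpace ℂ (H ⊗[ℂ] K))

/-- The elementary tensor `x ⊗ y`. -/
def PreTensor.mk (x : H) (y : K) : PreTensor H K := x ⊗ₜ[ℂ] y

@[elab_as_elim]
theorem PreTensor.induction {P : PreTensor H K → Prop} (ξ : PreTensor H K) (h0 : P 0)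
    (hm : ∀ x y, P (PreTensor.mk x y)) (ha : ∀ ξ η, P ξ → P η → P (ξ + η)) : P ξ :=
  TensorProduct.induction_on (motive := P) ξ h0 hm ha

theorem PreTensor.inner_mk (x x' : H) (y y' : K) :
    inner ℂ (PreTensor.mk x y) (PreTensor.mk x' y') = inner ℂ x x' * inner ℂ y y' :=
  TensorProduct.inner_tmul ..

/-- The operator `T ⊗ 1`. -/
def PreTensor.left (K : Type*) [NormedAddCommGroup K] [InnerProductSpace ℂ K] (T : H →L[ℂ] H) :
    PreTensor H K →L[ℂ] PreTensor H K := T.rTensor K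

/-- The operator `1 ⊗ T`. -/
def PreTensor.right (H : Type*) [NormedAddCommGroup H] [InnerProductSpace ℂ H] (T : K →L[ℂ] K) :
    PreTensor H K →L[ℂ] PreTensor H K := T.lTensor H

theorem PreTensor.left_mk (T : H →L[ℂ] H) (x : H) (y : K) :
    PreTensor.left K T (PreTensor.mk x y) = PreTensor.mk (T x) y :=
  ContinuousLinearMap.rTensor_tmul ..

theorem PreTensor.right_mk (T : K →L[ℂ] K) (x : H) (y : K) :
    PreTensor.right H T (PreTensor.mk x y) = PreTensor.mk x (T y) :=
  ContinuousLinearMap.lTensor_tmul ..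

theorem PreTensor.norm_left_le (T : H →L[ℂ] H) : ‖PreTensor.left K T‖ ≤ ‖T‖ :=
  ContinuousLinearMap.norm_rTensor_le K T

theorem PreTensor.norm_right_le (T : K →L[ℂ] K) : ‖PreTensor.right H T‖ ≤ ‖T‖ :=
  ContinuousLinearMap.norm_lTensor_le H T

theorem PreTensor.ext_mk {S T : PreTensor H K →L[ℂ] PreTensor H K}
    (h : ∀ x y, S (PreTensor.mk x y) = T (PreTensor.mk x y)) : S = T := by
  ext ξ
  induction ξ using PreTensor.induction with
  | h0 => simp
  | hm x y => exact h x y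
  | ha ξ η h1 h2 => rw [map_add, map_add, h1, h2]

theorem PreTensor.mk_add_left (x x' : H) (y : K) :
    PreTensor.mk (x + x') y = PreTensor.mk x y + PreTensor.mk x' y := TensorProduct.add_tmul x x' y

theorem PreTensor.mk_add_right (x : H) (y y' : K) :
    PreTensor.mk x (y + y') = PreTensor.mk x y + PreTensor.mk x y' := TensorProduct.tmul_add x y y'

theorem PreTensor.mk_smul_left (c : ℂ) (x : H) (y : K) :
    PreTensor.mk (c • x) y = c • PreTensor.mk x y := (TensorProduct.smul_tmul' c x y).symm

theorem PreTensor.mk_smul_right (c : ℂ) (x : H) (y : K) :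
    PreTensor.mk x (c • y) = c • PreTensor.mk x y := TensorProduct.tmul_smul c x y

variable {A B : Type*} [CStarAlgebra A] [CStarAlgebra B] [CompleteSpace H] [CompleteSpace K]

/-- For representations `π` of `A` on `H` and `ρ` of `B` on `K`, the representation
`a ⊗ b ↦ π a ⊗ ρ b` of the algebraic tensor product of `A` and `B` by bounded operators on the
algebraic tensor product of `H` and `K`. -/
def tensorRep (π : A →⋆ₐ[ℂ] (H →L[ℂ] H)) (ρ : B →⋆ₐ[ℂ] (K →L[ℂ] K)) :
    A ⊗[ℂ] B →ₐ[ℂ] (PreTensor H K →L[ℂ] PreTensor H K) :=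
  Algebra.TensorProduct.lift
    (AlgHom.ofLinearMap
      { toFun := fun a => PreTensor.left K (π a)
        map_add' := fun a b => PreTensor.ext_mk fun x y => by
          simp [PreTensor.left_mk, PreTensor.mk_add_left]
        map_smul' := fun c a => PreTensor.ext_mk fun x y => by
          simp [PreTensor.left_mk, PreTensor.mk_smul_left] }
      (PreTensor.ext_mk fun x y => by simp [PreTensor.left_mk])
      (fun a b => PreTensor.ext_mk fun x y => by simp [PreTensor.left_mk]))
    (AlgHom.ofLinearMap
      { toFun := fun b => PreTensor.right H (ρ b)
        map_add' := fun a b => PreTensor.ext_mk fun x y => by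
          simp [PreTensor.right_mk, PreTensor.mk_add_right]
        map_smul' := fun c a => PreTensor.ext_mk fun x y => by
          simp [PreTensor.right_mk, PreTensor.mk_smul_right] }
      (PreTensor.ext_mk fun x y => by simp [PreTensor.right_mk])
      (fun a b => PreTensor.ext_mk fun x y => by simp [PreTensor.right_mk]))
    (fun a b => PreTensor.ext_mk fun x y => by simp [PreTensor.left_mk, PreTensor.right_mk])

theorem tensorRep_tmul (π : A →⋆ₐ[ℂ] (H →L[ℂ] H)) (ρ : B →⋆ₐ[ℂ] (K →L[ℂ] K)) (a : A) (b : B) :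
    tensorRep π ρ (a ⊗ₜ b) = PreTensor.left K (π a) * PreTensor.right H (ρ b) := rfl

theorem tensorRep_tmul_mk (π : A →⋆ₐ[ℂ] (H →L[ℂ] H)) (ρ : B →⋆ₐ[ℂ] (K →L[ℂ] K)) (a : A) (b : B)
    (x : H) (y : K) :
    tensorRep π ρ (a ⊗ₜ b) (PreTensor.mk x y) = PreTensor.mk (π a x) (ρ b y) := by
  rw [tensorRep_tmul, mul_apply_eq_comp, PreTensor.right_mk, PreTensor.left_mk]

theorem norm_tensorRep_tmul_le (π : A →⋆ₐ[ℂ] (H →L[ℂ] H)) (ρ : B →⋆ₐ[ℂ] (K →L[ℂ] K))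
    (a : A) (b : B) : ‖tensorRep π ρ (a ⊗ₜ b)‖ ≤ ‖a‖ * ‖b‖ := by
  rw [tensorRep_tmul]
  exact (norm_mul_le _ _).trans (mul_le_mul
    ((PreTensor.norm_left_le _).trans (NonUnitalStarAlgHom.norm_apply_le π a))
    ((PreTensor.norm_right_le _).trans (NonUnitalStarAlgHom.norm_apply_le ρ b))
    (norm_nonneg _) (norm_nonneg _))

theorem inner_tensorRep (π : A →⋆ₐ[ℂ] (H →L[ℂ] H)) (ρ : B →⋆ₐ[ℂ] (K →L[ℂ] K)) (t : A ⊗[ℂ] B)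
    (ξ η : PreTensor H K) :
    inner ℂ (tensorRep π ρ t ξ) η = inner ℂ ξ (tensorRep π ρ (star t) η) := by
  induction t using TensorProduct.induction_on with
  | zero => simp
  | add s t hs ht => rw [map_add, star_add, map_add, add_apply, inner_add_left, hs, ht, add_apply, inner_add_right]
  | tmul a b =>
    rw [TensorProduct.star_tmul]
    induction ξ using PreTensor.induction with
    | h0 => simp
    | ha ξ ξ' h h' => rw [map_add, inner_add_left, h, h', inner_add_left]
    | hm x y =>
      induction η using PreTensor.induction with
      | h0 => simp
      | ha η η' h h' => rw [map_add, inner_add_right, h, h', inner_add_right]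
      | hm x' y' =>
        rw [tensorRep_tmul_mk, tensorRep_tmul_mk, PreTensor.inner_mk, PreTensor.inner_mk,
          map_star, map_star, ContinuousLinearMap.star_eq_adjoint,
          ContinuousLinearMap.star_eq_adjoint, ContinuousLinearMap.adjoint_inner_right,
          ContinuousLinearMap.adjoint_inner_right]

/-- The C⋆-seminorm `t ↦ ‖(π ⊗ ρ) t‖` on the algebraic tensor product. -/
def repSeminorm (π : A →⋆ₐ[ℂ] (H →L[ℂ] H)) (ρ : B →⋆ₐ[ℂ] (K →L[ℂ] K)) :
    CStarSeminorm (A ⊗[ℂ] B) where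
  toFun t := ‖tensorRep π ρ t‖
  map_zero' := by simp
  add_le' s t := by rw [map_add]; exact norm_add_le _ _
  neg' t := by rw [map_neg, norm_neg]
  smul' c t := by rw [map_smul, norm_smul]
  mul_le' s t := by rw [map_mul]; exact norm_mul_le _ _
  star_mul_self' t := by
    have key (t : A ⊗[ℂ] B) :
        ‖tensorRep π ρ t‖ * ‖tensorRep π ρ t‖ ≤ ‖tensorRep π ρ (star t * t)‖ := by
      have h : ‖tensorRep π ρ t‖ ≤ √‖tensorRep π ρ (star t * t)‖ := by
        refine ContinuousLinearMap.opNorm_le_bound _ (Real.sqrt_nonneg _) fun ξ => ?_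
        have h1 : ‖tensorRep π ρ t ξ‖ ^ 2 ≤ ‖tensorRep π ρ (star t * t)‖ * ‖ξ‖ ^ 2 := by
          rw [← inner_self_eq_norm_sq (𝕜 := ℂ), inner_tensorRep, ← mul_apply_eq_comp,
            ← map_mul]
          refine (RCLike.re_le_norm _).trans ((norm_inner_le_norm _ _).trans ?_)
          have := (tensorRep π ρ (star t * t)).le_opNorm ξ
          nlinarith [norm_nonneg ξ]
        rw [← Real.sqrt_sq (norm_nonneg ξ), ← Real.sqrt_mul (norm_nonneg _)]
        exact Real.le_sqrt_of_sq_le h1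
      calc _ ≤ √‖tensorRep π ρ (star t * t)‖ * √‖tensorRep π ρ (star t * t)‖ :=
            mul_le_mul h h (norm_nonneg _) (Real.sqrt_nonneg _)
        _ = _ := Real.mul_self_sqrt (norm_nonneg _)
    have le_star (t : A ⊗[ℂ] B) : ‖tensorRep π ρ t‖ ≤ ‖tensorRep π ρ (star t)‖ := by
      rcases (norm_nonneg (tensorRep π ρ t)).eq_or_lt with h | h
      · rw [← h]; exact norm_nonneg _
      · have h1 := key t
        rw [map_mul] at h1
        exact le_of_mul_le_mul_right (h1.trans (norm_mul_le _ _)) h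
    refine le_antisymm ?_ (key t)
    rw [map_mul]
    refine (norm_mul_le _ _).trans (mul_le_mul_of_nonneg_right ?_ (norm_nonneg _))
    simpa using le_star (star t)

end Spatial

/-- The C⋆-seminorms on the algebraic tensor product `A ⊗ B` coming from pairs of
representations of `A` and `B` on Hilbert spaces. -/
def spatialSeminorms (A : Type v) (B : Type w) [CStarAlgebra A] [CStarAlgebra B] :
    Set (CStarSeminorm (A ⊗[ℂ] B)) :=
  {p | ∃ (H : Type v) (_ : NormedAddCommGroup H) (_ : InnerProductSpace ℂ H) (_ : CompleteSpace H)
    (K : Type w) (_ : NormedAddCommGroup K) (_ : InnerProductSpace ℂ K) (_ : CompleteSpace K)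
    (π : A →⋆ₐ[ℂ] (H →L[ℂ] H)) (ρ : B →⋆ₐ[ℂ] (K →L[ℂ] K)), p = repSeminorm π ρ}

theorem spatialSeminorms_bddAbove (A : Type v) (B : Type w) [CStarAlgebra A] [CStarAlgebra B]
    (t : A ⊗[ℂ] B) : BddAbove (Set.range fun q : spatialSeminorms A B => q.1 t) := by
  have key : ∃ C, ∀ p ∈ spatialSeminorms A B, p t ≤ C := by
    induction t using TensorProduct.induction_on with
    | zero => exact ⟨0, fun p _ => (map_zero p.toSeminorm).le⟩
    | tmul a b =>
      refine ⟨‖a‖ * ‖b‖, ?_⟩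
      rintro p ⟨H, _, _, _, K, _, _, _, π, ρ, rfl⟩
      exact norm_tensorRep_tmul_le π ρ a b
    | add s t hs ht =>
      obtain ⟨C, hC⟩ := hs
      obtain ⟨D, hD⟩ := ht
      exact ⟨C + D, fun p hp => (p.add_le s t).trans (add_le_add (hC p hp) (hD p hp))⟩
  obtain ⟨C, hC⟩ := key
  exact ⟨C, by rintro _ ⟨q, rfl⟩; exact hC q.1 q.2⟩

/-- The spatial (minimal) tensor product of two C⋆-algebras: the completion of the algebraic
tensor product for the norm `‖t‖ = sup ‖(π ⊗ ρ) t‖`, over all representations `π` of `A` and `ρ`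
of `B` on Hilbert spaces. -/
abbrev SpatialTensor (A : Type v) (B : Type w) [CStarAlgebra A] [CStarAlgebra B] : Type _ :=
  (CStarSeminorm.sup (spatialSeminorms A B) (spatialSeminorms_bddAbove A B)).Completion

/-- The elementary tensor `a ⊗ b` in the spatial tensor product. -/
def SpatialTensor.tmul {A : Type v} {B : Type w} [CStarAlgebra A] [CStarAlgebra B]
    (a : A) (b : B) : SpatialTensor A B :=
  (CStarSeminorm.sup (spatialSeminorms A B) (spatialSeminorms_bddAbove A B)).toCompletion (a ⊗ₜ b)

/-! ### Compact quantum groups -/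

/-- The ⋆-subalgebra generated by the entries of a matrix `u`. -/
abbrev coeffAlg {N : ℕ} {A : Type v} [CStarAlgebra A] (u : Fin N → Fin N → A) :
    StarSubalgebra ℂ A :=
  StarAlgebra.adjoin ℂ (Set.range fun p : Fin N × Fin N => u p.1 p.2)

/-- The entry `u i j`, as an element of the ⋆-subalgebra generated by the entries of `u`. -/
def coeffAlg.entry {N : ℕ} {A : Type v} [CStarAlgebra A] (u : Fin N → Fin N → A) (i j : Fin N) :
    coeffAlg u :=
  ⟨u i j, StarAlgebra.subset_adjoin ℂ _ ⟨(i, j), rfl⟩⟩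

/-- Woronowicz's compact matrix quantum groups: the pair `(A, u)`, with `A = C(G)` a unital
C⋆-algebra and `u` an `N × N` matrix over it, such that the entries of `u` generate a dense
⋆-subalgebra `𝒜` of `A`, there is a comultiplication `Δ : A → A ⊗ A` with
`Δ (u i j) = ∑ k, u i k ⊗ u k j`, and there is an antipode on `𝒜`, that is, a linear
antimultiplicative map `κ : 𝒜 → 𝒜` with `κ (κ (a⋆)⋆) = a` such that `(κ (u i j))` is inverse
to the matrix `u`. -/
structure IsCompactMatrixQuantumGroup {N : ℕ} {A : Type v} [CStarAlgebra A]
    (u : Fin N → Fin N → A) : Prop where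
  dense : Dense (coeffAlg u : Set A)
  comul : ∃ Δ : A →⋆ₐ[ℂ] SpatialTensor A A,
    ∀ i j, Δ (u i j) = ∑ k, SpatialTensor.tmul (u i k) (u k j)
  antipode : ∃ κ : coeffAlg u →ₗ[ℂ] coeffAlg u,
    (∀ a b, κ (a * b) = κ b * κ a) ∧ (∀ a, κ (star (κ (star a))) = a) ∧
    (∀ i j, ∑ k, κ (coeffAlg.entry u i k) * coeffAlg.entry u k j = if i = j then 1 else 0) ∧
    (∀ i j, ∑ k, coeffAlg.entry u i k * κ (coeffAlg.entry u k j) = if i = j then 1 else 0)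

/-- The inclusion `G ⊂ K` of quantum groups with standard coordinates `u i j ∈ C(G)` and
`w i j ∈ C(K)`: there is a morphism `C(K) → C(G)` with `w i j ↦ u i j`. (When the `u i j`
generate `C(G)` it is onto, and it automatically respects the comultiplications.) -/
def IsQuantumSubgroup {N : ℕ} {A : Type v} {B : Type w} [CStarAlgebra A] [CStarAlgebra B]
    (u : Fin N → Fin N → A) (w : Fin N → Fin N → B) : Prop :=
  ∃ f : B →⋆ₐ[ℂ] A, ∀ i j, f (w i j) = u i j

/-- Relators for the free orthogonal quantum group: `u` is orthogonal, `u uᵗ = uᵗ u = 1`. -/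
def orthogonalRel (N : ℕ) : Set (FreeStarAlg (Fin N × Fin N)) :=
  {r | ∃ i j, r = (∑ k, FreeStarAlg.X (i, k) * FreeStarAlg.X (j, k)) - if i = j then 1 else 0} ∪
  {r | ∃ i j, r = (∑ k, FreeStarAlg.X (k, i) * FreeStarAlg.X (k, j)) - if i = j then 1 else 0}

theorem orthogonalRel_bounded {N : ℕ} {R : Set (FreeStarAlg (Fin N × Fin N))}
    (h : orthogonalRel N ⊆ R) : FreeStarAlg.Bounded R := fun i => ⟨1, fun p hp =>
  FreeStarAlg.le_one_of_sum_sq p (fun k => (i.1, k))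
    (hp _ (h (Or.inl ⟨i.1, i.1, by simp⟩))) i.2⟩

/-- The algebra `C(O_N⁺)`. -/
abbrev FreeOrthogonal (N : ℕ) : Type :=
  UniversalCStar (orthogonalRel N) (orthogonalRel_bounded subset_rfl)

/-- The standard coordinates of `O_N⁺`. -/
def FreeOrthogonal.u (N : ℕ) (i j : Fin N) : FreeOrthogonal N :=
  UniversalCStar.gen (orthogonalRel N) (orthogonalRel_bounded subset_rfl) (i, j)

/-- Relators for `H_N^[∞] ⊂ O_N⁺`: the orthogonality relations, and `a b c = 0` for entries
`a, b, c` of `u` such that `a ≠ c` lie on the same row or on the same column. -/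
def hyperoctahedralInftyRel (N : ℕ) : Set (FreeStarAlg (Fin N × Fin N)) :=
  orthogonalRel N ∪ {r | ∃ a b c : Fin N × Fin N, a ≠ c ∧ (a.1 = c.1 ∨ a.2 = c.2) ∧
    r = FreeStarAlg.X a * FreeStarAlg.X b * FreeStarAlg.X c}

/-- The algebra `C(H_N^[∞])`. -/
abbrev HyperoctahedralInfty (N : ℕ) : Type :=
  UniversalCStar (hyperoctahedralInftyRel N) (orthogonalRel_bounded Set.subset_union_left)

/-- The standard coordinates of `H_N^[∞]`. -/
def HyperoctahedralInfty.u (N : ℕ) (i j : Fin N) : HyperoctahedralInfty N :=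
  UniversalCStar.gen (hyperoctahedralInftyRel N) (orthogonalRel_bounded Set.subset_union_left) (i, j)

/-! ### Noncommutative spheres and affine actions -/

/-- Relator for the free real sphere: `∑ i, x i ^ 2 = 1`. -/
def sphereRel (N : ℕ) : Set (FreeStarAlg (Fin N)) :=
  {(∑ i, FreeStarAlg.X i * FreeStarAlg.X i) - 1}

theorem sphereRel_bounded {N : ℕ} {R : Set (FreeStarAlg (Fin N))} (h : sphereRel N ⊆ R) :
    FreeStarAlg.Bounded R := fun i => ⟨1, fun p hp =>
  FreeStarAlg.le_one_of_sum_sq p id (hp _ (h rfl)) i⟩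

/-- Relators for the polygonal half-liberated sphere `S^{N-1,1}_{ℝ,*}`: the sphere relation, the
half-commutation relations `x i * x j * x k = x k * x j * x i` for all `i, j, k`, and
`x i * x j * x k = 0` for `i, j, k` distinct. -/
def polygonalHalfSphereRel (N : ℕ) : Set (FreeStarAlg (Fin N)) :=
  sphereRel N ∪
  ({r | ∃ i j k, r = FreeStarAlg.X i * FreeStarAlg.X j * FreeStarAlg.X k -
      FreeStarAlg.X k * FreeStarAlg.X j * FreeStarAlg.X i} ∪
   {r | ∃ i j k, i ≠ j ∧ i ≠ k ∧ j ≠ k ∧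
      r = FreeStarAlg.X i * FreeStarAlg.X j * FreeStarAlg.X k})

/-- The algebra `C(S^{N-1,1}_{ℝ,*})`. -/
abbrev PolygonalHalfSphere (N : ℕ) : Type :=
  UniversalCStar (polygonalHalfSphereRel N) (sphereRel_bounded Set.subset_union_left)

/-- The standard coordinates of `S^{N-1,1}_{ℝ,*}`. -/
def PolygonalHalfSphere.x (N : ℕ) (i : Fin N) : PolygonalHalfSphere N :=
  UniversalCStar.gen (polygonalHalfSphereRel N) (sphereRel_bounded Set.subset_union_left) i

/-- The closed subgroups `G ⊂ O_N⁺`, given by `C(G)` and the standard coordinates `u i j`. -/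
def IsClosedSubgroupOfFreeOrthogonal {N : ℕ} {A : Type v} [CStarAlgebra A]
    (u : Fin N → Fin N → A) : Prop :=
  IsCompactMatrixQuantumGroup u ∧ IsQuantumSubgroup u (FreeOrthogonal.u N)

/-- The quantum group `G` with standard coordinates `u i j ∈ C(G)` acts affinely on the space `X`
with standard coordinates `x i ∈ C(X)`: there is a morphism `Φ : C(X) → C(G) ⊗ C(X)` with
`Φ (x i) = ∑ j, u i j ⊗ x j`. -/
def ActsAffinely {N : ℕ} {A : Type v} {B : Type w} [CStarAlgebra A] [CStarAlgebra B]
    (u : Fin N → Fin N → A) (x : Fin N → B) : Prop :=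
  ∃ Φ : B →⋆ₐ[ℂ] SpatialTensor A B, ∀ i, Φ (x i) = ∑ j, SpatialTensor.tmul (u i j) (x j)

/-- `G`, with standard coordinates `u i j ∈ C(G)`, is the quantum isometry group `G⁺(X)`: the
universal (largest) closed subgroup of `O_N⁺` acting affinely on `X`. -/
structure IsQuantumIsometryGroup {N : ℕ} {A : Type v} {B : Type w} [CStarAlgebra A]
    [CStarAlgebra B] (u : Fin N → Fin N → A) (x : Fin N → B) : Prop where
  closedSubgroup : IsClosedSubgroupOfFreeOrthogonal u
  acts : ActsAffinely u x
  universal : ∀ (A' : Type z) [CStarAlgebra A'] (u' : Fin N → Fin N → A'),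
    IsClosedSubgroupOfFreeOrthogonal u' → ActsAffinely u' x → IsQuantumSubgroup u' u

end

/-! If `u` acts affinely, the elements `X i = ∑ j, u i j ⊗ x j` satisfy the relations of the sphere.
Expanding a cubic relation gives a sum of terms `T a b c ⊗ x a x b x c`, and the coefficients `T a b
a` can be read off (`SpatialTensor.coeff_eq_zero`): points of the complex sphere with at most two
non-zero coordinates give antidiagonal `2 × 2` models of the sphere, and varying the phase of one
coordinate isolates `x a x b x a`. Slicing is legitimate because Hilbert space representations
separate the points of a C⋆-algebra (Hahn–Banach and GNS).

The polygonal relation then yields `u i a * u j b * u k a = 0` for `i, j, k` distinct, and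
half-commutation makes `u i a ^ 2` commute with `u k a`. Together with orthogonality these already
force every relation of `H_N^[∞]` when `N ≥ 3`. The main step is
`IsOrthogonalMatrix.col_mul_eq_zero`, where a third index `j` serves to show that distinct entries
of one column are orthogonal.

Conversely, the relations of `H_N^[∞]` make the squares of the entries commute with all entries. A
comparison of coefficients of `x a x b x c` then shows that `H_N^[∞]` acts. The same relations are
stable under products `∑ k, u i k ⊗ v k j` and under transposition into the opposite algebra, so the
universal property supplies the comultiplication and the antipode. -/

/-! ### The universal property of universal C⋆-algebras -/

namespace FreeStarAlg

variable {ι B : Type*} [CStarAlgebra B]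

/-- Evaluation of noncommutative polynomials at a family of elements. -/
noncomputable def eval (y : ι → B) : FreeStarAlg ι →ₐ[ℂ] B :=
  MonoidAlgebra.lift ℂ B (FreeMonoid ι) (FreeMonoid.lift y)

theorem eval_monomial (y : ι → B) (w : FreeMonoid ι) (c : ℂ) :
    eval y (monomial w c) = c • FreeMonoid.lift y w :=
  MonoidAlgebra.lift_single ..

@[simp]
theorem eval_X (y : ι → B) (i : ι) : eval y (X i) = y i := by
  change eval y (monomial (FreeMonoid.of i) 1) = y i
  rw [eval_monomial, one_smul, FreeMonoid.lift_eval_of]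

theorem eval_star {y : ι → B} (hy : ∀ i, star (y i) = y i) (f : FreeStarAlg ι) :
    eval y (star f) = star (eval y f) := by
  refine induction f (by simp) (fun f g hf hg => by simp [hf, hg]) fun w c => ?_
  have key : FreeMonoid.lift y (star w) = star (FreeMonoid.lift y w) := by
    induction w using FreeMonoid.inductionOn' with
    | one => simp
    | of_mul i w ih => simp [ih, hy]
  rw [star_monomial, eval_monomial, eval_monomial, star_smul, key]

/-- The C⋆-seminorm `f ↦ ‖f(y)‖` given by a family of self-adjoint elements. -/
noncomputable def evalSeminorm (y : ι → B) (hy : ∀ i, star (y i) = y i) :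
    CStarSeminorm (FreeStarAlg ι) where
  toFun f := ‖eval y f‖
  map_zero' := by simp
  add_le' f g := by rw [map_add]; exact norm_add_le _ _
  neg' f := by rw [map_neg, norm_neg]
  smul' c f := by rw [map_smul, norm_smul]
  mul_le' f g := by rw [map_mul]; exact norm_mul_le _ _
  star_mul_self' f := by rw [map_mul, eval_star hy, CStarRing.norm_star_mul_self]

theorem evalSeminorm_apply (y : ι → B) (hy : ∀ i, star (y i) = y i) (f : FreeStarAlg ι) :
    evalSeminorm y hy f = ‖eval y f‖ := rfl

end FreeStarAlg

theorem CStarSeminorm.le_sup {F : Type*} [Ring F] [StarRing F] [Algebra ℂ F]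
    {S : Set (CStarSeminorm F)} (hS : ∀ a, BddAbove (Set.range fun q : S => q.1 a))
    {p : CStarSeminorm F} (hp : p ∈ S) (a : F) : p a ≤ CStarSeminorm.sup S hS a :=
  le_ciSup (hS a) ⟨p, hp⟩

theorem CStarSeminorm.sup_eq_zero {F : Type*} [Ring F] [StarRing F] [Algebra ℂ F]
    {S : Set (CStarSeminorm F)} (hS : ∀ a, BddAbove (Set.range fun q : S => q.1 a))
    {a : F} (ha : ∀ p ∈ S, p a = 0) : CStarSeminorm.sup S hS a = 0 :=
  le_antisymm (Real.iSup_le (fun q => (ha q.1 q.2).le) le_rfl) (CStarSeminorm.nonneg _ _)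

theorem CStarSeminorm.toCompletion_eq_zero_iff {F : Type*} [Ring F] [StarRing F] [Algebra ℂ F]
    (p : CStarSeminorm F) {a : F} : p.toCompletion a = 0 ↔ p a = 0 := by
  rw [← p.norm_toCompletion, norm_eq_zero]

theorem CStarSeminorm.denseRange_toCompletion {F : Type*} [Ring F] [StarRing F] [Algebra ℂ F]
    (p : CStarSeminorm F) : DenseRange p.toCompletion :=
  UniformSpace.Completion.denseRange_coe (α := p.Carrier)

namespace UniversalCStar

variable {ι B : Type*} [CStarAlgebra B] {R : Set (FreeStarAlg ι)} (hR : FreeStarAlg.Bounded R)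

/-- The canonical map from noncommutative polynomials to the universal C⋆-algebra. -/
noncomputable def mk : FreeStarAlg ι →ₐ[ℂ] UniversalCStar R hR :=
  (CStarSeminorm.sup (FreeStarAlg.relSeminorms R) hR.bddAbove).toCompletion

theorem mk_X (i : ι) : mk hR (FreeStarAlg.X i) = gen R hR i := rfl

theorem mk_star (f : FreeStarAlg ι) : mk hR (star f) = star (mk hR f) :=
  CStarSeminorm.toCompletion_star _ f

theorem mk_rel {r : FreeStarAlg ι} (hr : r ∈ R) : mk hR r = 0 :=
  (CStarSeminorm.toCompletion_eq_zero_iff _).2 (CStarSeminorm.sup_eq_zero _ fun _ hp => hp r hr)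

theorem denseRange_mk : DenseRange (mk hR) := CStarSeminorm.denseRange_toCompletion _

theorem star_gen (i : ι) : star (gen R hR i) = gen R hR i := by
  rw [← mk_X, ← mk_star, FreeStarAlg.star_X]

/-- Self-adjoint elements satisfying the relations `R` define a morphism from the universal
C⋆-algebra. -/
theorem exists_lift (y : ι → B) (hy : ∀ i, star (y i) = y i)
    (hrel : ∀ r ∈ R, FreeStarAlg.eval y r = 0) :
    ∃ φ : UniversalCStar R hR →⋆ₐ[ℂ] B, ∀ i, φ (gen R hR i) = y i := by
  let p := CStarSeminorm.sup (FreeStarAlg.relSeminorms R) hR.bddAbove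
  -- The norm of evaluation is itself one of the seminorms in the supremum, so evaluation is
  -- contractive and extends to the completion. The supremum runs over seminorms rather than
  -- representations, hence `B` may lie in any universe.
  have hle (f : FreeStarAlg ι) : ‖FreeStarAlg.eval y f‖ ≤ p f :=
    CStarSeminorm.le_sup hR.bddAbove (p := FreeStarAlg.evalSeminorm y hy)
      (fun r hr => by rw [FreeStarAlg.evalSeminorm_apply, hrel r hr, norm_zero]) f
  let e : p.Carrier →+* B := (FreeStarAlg.eval y).toRingHom
  have he : Continuous e :=
    AddMonoidHomClass.continuous_of_bound e 1 fun f => by rw [one_mul]; exact hle f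
  let E : p.Completion →+* B := UniformSpace.Completion.extensionHom e he
  have hE (f : FreeStarAlg ι) : E (mk hR f) = FreeStarAlg.eval y f :=
    UniformSpace.Completion.extensionHom_coe e he f
  have hEc : Continuous E := UniformSpace.Completion.continuous_extension
  refine ⟨{ E with
    commutes' := fun c => ?_
    map_star' := fun a => ?_ }, fun i => ?_⟩
  · change E (algebraMap ℂ (UniversalCStar R hR) c) = _
    rw [← AlgHom.commutes (mk hR), hE, AlgHom.commutes]
  · change E (star a) = star (E a)
    refine (denseRange_mk hR).induction_on
      (p := fun a : UniversalCStar R hR => E (star a) = star (E a)) a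
      (isClosed_eq (hEc.comp continuous_star) (continuous_star.comp hEc)) fun f => ?_
    rw [← mk_star, hE, hE, FreeStarAlg.eval_star hy]
  · change E (mk hR (FreeStarAlg.X i)) = _
    rw [hE, FreeStarAlg.eval_X]

theorem mk_mem_adjoin (f : FreeStarAlg ι) :
    mk hR f ∈ StarAlgebra.adjoin ℂ (Set.range (gen R hR)) := by
  refine FreeStarAlg.induction f (by rw [map_zero]; exact zero_mem _)
    (fun f g hf hg => by rw [map_add]; exact add_mem hf hg) fun w c => ?_
  have h (w : FreeMonoid ι) (c : ℂ) :
      FreeStarAlg.monomial w c = c • FreeStarAlg.monomial w 1 := by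
    rw [FreeStarAlg.smul_monomial, mul_one]
  rw [h, map_smul]
  refine SMulMemClass.smul_mem c ?_
  induction w using FreeMonoid.inductionOn' with
  | one => change mk hR 1 ∈ _; rw [map_one]; exact one_mem _
  | of_mul i w ih =>
    have h2 : FreeStarAlg.monomial (FreeMonoid.of i * w) 1 =
        FreeStarAlg.X i * FreeStarAlg.monomial w 1 := by
      change _ = FreeStarAlg.monomial (FreeMonoid.of i) 1 * FreeStarAlg.monomial w 1
      rw [FreeStarAlg.monomial_mul, one_mul]
    rw [h2, map_mul]
    exact mul_mem (StarAlgebra.subset_adjoin ℂ _ ⟨i, rfl⟩) ih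

theorem dense_adjoin_gen :
    Dense (StarAlgebra.adjoin ℂ (Set.range (gen R hR)) : Set (UniversalCStar R hR)) :=
  (denseRange_mk hR).mono (Set.range_subset_iff.2 (mk_mem_adjoin hR))

end UniversalCStar

/-! ### Hilbert space representations separate the points of a C⋆-algebra -/

section Separation

open scoped ComplexOrder

/-- The positive cone is closed and does not contain `-a`, so Hahn–Banach separates the two by a
real functional that is non-negative on the cone. -/
theorem exists_positiveLinearMap_ne_zero {A : Type v} [CStarAlgebra A] [PartialOrder A]
    [StarOrderedRing A] {a : A} (ha : 0 ≤ a) (h0 : a ≠ 0) : ∃ f : A →ₚ[ℂ] ℂ, f a ≠ 0 := by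
  let C : ProperCone ℝ A :=
    { carrier := {x | 0 ≤ x}
      add_mem' := fun hx hy => add_nonneg hx hy
      zero_mem' := le_rfl
      smul_mem' := fun c x hx => smul_nonneg c.2 hx
      isClosed' := CStarAlgebra.isClosed_nonneg }
  have hC : -a ∉ C := fun h => h0 (le_antisymm (neg_nonneg.1 h) ha)
  obtain ⟨f, hf, hfa⟩ := C.hyperplane_separation_point hC
  -- Symmetrizing under `star` kills the values on `i` times a positive element, so the complex
  -- extension `F` of `g` equals `2 f` on the positive cone.
  let g : Module.Dual ℝ A := f.toLinearMap ∘ₗ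
    (LinearMap.id + (starLinearEquiv ℝ (A := A)).toLinearMap)
  have hg (x : A) : g x = f x + f (star x) := by simp [g]
  have hgI (x : A) (hx : 0 ≤ x) : g (Complex.I • x) = 0 := by
    rw [hg, star_smul, (IsSelfAdjoint.of_nonneg hx).star_eq, ← map_add, ← add_smul]
    simp
  let F : Module.Dual ℂ A := g.extendRCLike
  have hF (x : A) (hx : 0 ≤ x) : F x = ((2 * f x : ℝ) : ℂ) := by
    have h1 := hgI x hx
    have h2 := hg x
    rw [(IsSelfAdjoint.of_nonneg hx).star_eq] at h2
    have h3 : F x = (g x : ℂ) - Complex.I * (g (Complex.I • x) : ℂ) :=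
      Module.Dual.extendRCLike_apply g x
    rw [h3, h1, h2]
    simp [two_mul]
  refine ⟨PositiveLinearMap.mk₀ F fun x hx => ?_, ?_⟩
  · rw [hF x hx]
    exact_mod_cast mul_nonneg zero_le_two (hf x hx)
  · change F a ≠ 0
    rw [hF a ha, map_neg] at *
    have : 0 < f a := by linarith
    exact_mod_cast (by positivity : 2 * f a ≠ 0)

/-- If `a ≠ 0`, some positive `f` has `f (star a * a) ≠ 0`, and this is the squared norm of `a`
applied to the cyclic vector in the GNS space of `f`. That space lies in the universe of `A`, as
`spatialSeminorms` requires. -/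
theorem eq_zero_of_forall_representation {A : Type v} [CStarAlgebra A] {a : A}
    (h : ∀ (H : Type v) [NormedAddCommGroup H] [InnerProductSpace ℂ H] [CompleteSpace H]
      (π : A →⋆ₐ[ℂ] (H →L[ℂ] H)), π a = 0) : a = 0 := by
  let _ : PartialOrder A := CStarAlgebra.spectralOrder A
  let _ : StarOrderedRing A := CStarAlgebra.spectralOrderedRing A
  by_contra h0
  obtain ⟨f, hf⟩ := exists_positiveLinearMap_ne_zero (star_mul_self_nonneg a)
    (fun h => h0 (CStarRing.star_mul_self_eq_zero_iff a |>.1 h))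
  refine hf ?_
  have h1 : f.gnsStarAlgHom a (f.toPreGNS 1 : f.PreGNS) = 0 := by rw [h f.GNS]; rfl
  change f.gnsNonUnitalStarAlgHom a _ = 0 at h1
  rw [PositiveLinearMap.gnsNonUnitalStarAlgHom_apply_coe,
    ← norm_eq_zero, UniformSpace.Completion.norm_coe] at h1
  have h2 := f.preGNS_norm_sq (f.leftMulMapPreGNS a (f.toPreGNS 1))
  rw [h1] at h2
  simpa using h2.symm

end Separation

/-! ### Slice maps -/

/-- The functional `b ↦ ⟪η', ρ b η⟫`. -/
noncomputable def vectorFunctional {B K : Type*} [CStarAlgebra B] [NormedAddCommGroup K]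
    [InnerProductSpace ℂ K] [CompleteSpace K] (ρ : B →⋆ₐ[ℂ] (K →L[ℂ] K)) (η η' : K) :
    B →ₗ[ℂ] ℂ where
  toFun b := inner ℂ η' (ρ b η)
  map_add' b c := by simp
  map_smul' c b := by simp

/-- The slice map `a ⊗ b ↦ φ b • a`. -/
noncomputable def slice {A B : Type*} [CStarAlgebra A] [CStarAlgebra B] (φ : B →ₗ[ℂ] ℂ) :
    A ⊗[ℂ] B →ₗ[ℂ] A :=
  (TensorProduct.rid ℂ A).toLinearMap ∘ₗ LinearMap.lTensor A φ

@[simp]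
theorem slice_tmul {A B : Type*} [CStarAlgebra A] [CStarAlgebra B] (φ : B →ₗ[ℂ] ℂ)
    (a : A) (b : B) : slice φ (a ⊗ₜ b) = φ b • a := by
  simp [slice]

namespace SpatialTensor

/-- The canonical map from the algebraic to the spatial tensor product. -/
noncomputable def mk (A : Type v) (B : Type w) [CStarAlgebra A] [CStarAlgebra B] :
    A ⊗[ℂ] B →ₐ[ℂ] SpatialTensor A B :=
  (CStarSeminorm.sup (spatialSeminorms A B) (spatialSeminorms_bddAbove A B)).toCompletion

variable {A : Type v} {B : Type w} [CStarAlgebra A] [CStarAlgebra B]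

theorem mk_star (t : A ⊗[ℂ] B) : mk A B (star t) = star (mk A B t) :=
  CStarSeminorm.toCompletion_star _ t

/-- For each `π`, the matrix coefficients of `π (slice t)` are coefficients of `(π ⊗ ρ) t` between
elementary tensors, and these are controlled by the spatial norm. -/
theorem slice_eq_zero {t : A ⊗[ℂ] B} (ht : mk A B t = 0) {K : Type w} [NormedAddCommGroup K]
    [InnerProductSpace ℂ K] [CompleteSpace K] (ρ : B →⋆ₐ[ℂ] (K →L[ℂ] K)) (η η' : K) :
    slice (vectorFunctional ρ η η') t = 0 := by
  refine eq_zero_of_forall_representation fun H _ _ _ π => ?_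
  have h0 : tensorRep π ρ t = 0 := by
    have h1 := (CStarSeminorm.toCompletion_eq_zero_iff _).1 ht
    have h2 := CStarSeminorm.le_sup (spatialSeminorms_bddAbove A B) (p := repSeminorm π ρ)
      ⟨H, _, _, ‹_›, K, _, _, ‹_›, π, ρ, rfl⟩ t
    rw [h1] at h2
    exact norm_le_zero_iff.1 h2
  have key (t : A ⊗[ℂ] B) (ξ ξ' : H) :
      inner ℂ ξ' (π (slice (vectorFunctional ρ η η') t) ξ) =
        inner ℂ (PreTensor.mk ξ' η') (tensorRep π ρ t (PreTensor.mk ξ η)) := by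
    induction t using TensorProduct.induction_on with
    | zero => simp
    | add s t hs ht => simp [hs, ht]
    | tmul a b =>
      rw [slice_tmul, tensorRep_tmul_mk, PreTensor.inner_mk, map_smul, smul_apply,
        inner_smul_right, mul_comm]
      rfl
  ext ξ
  refine ext_inner_left ℂ fun ξ' => ?_
  rw [key, h0]
  simp

end SpatialTensor

/-! ### Orthogonal matrices over C⋆-algebras -/

section Orthogonal

variable {N : ℕ} {A : Type*} [CStarAlgebra A]

theorem eq_zero_of_sum_mul_star_eq_zero {κ : Type*} {s : Finset κ} {y : κ → A}
    (h : ∑ c ∈ s, y c * star (y c) = 0) {c : κ} (hc : c ∈ s) : y c = 0 := by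
  let _ : PartialOrder A := CStarAlgebra.spectralOrder A
  let _ : StarOrderedRing A := CStarAlgebra.spectralOrderedRing A
  have := (Finset.sum_eq_zero_iff_of_nonneg fun c _ => mul_star_self_nonneg (y c)).1 h c hc
  exact (CStarRing.mul_star_self_eq_zero_iff _).1 this

/-- A matrix of self-adjoint elements with `u uᵗ = uᵗ u = 1`. -/
structure IsOrthogonalMatrix (u : Fin N → Fin N → A) : Prop where
  star_eq : ∀ i j, star (u i j) = u i j
  row : ∀ i j, ∑ k, u i k * u j k = if i = j then 1 else 0
  col : ∀ i j, ∑ k, u k i * u k j = if i = j then 1 else 0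

/-- An orthogonal matrix with `a b c = 0` for entries `a, b, c` such that `a ≠ c` lie on the same
row or on the same column. -/
structure IsHyperoctahedralInftyMatrix (u : Fin N → Fin N → A) : Prop
    extends IsOrthogonalMatrix u where
  mul_mul_eq_zero : ∀ a b c : Fin N × Fin N, a ≠ c → (a.1 = c.1 ∨ a.2 = c.2) →
    u a.1 a.2 * u b.1 b.2 * u c.1 c.2 = 0

theorem FreeStarAlg.eval_orthogonalRel {u : Fin N → Fin N → A} :
    (∀ r ∈ orthogonalRel N, FreeStarAlg.eval (fun p : Fin N × Fin N => u p.1 p.2) r = 0) ↔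
      (∀ i j, ∑ k, u i k * u j k = if i = j then 1 else 0) ∧
      (∀ i j, ∑ k, u k i * u k j = if i = j then 1 else 0) := by
  have h (i j : Fin N) (g : Fin N → FreeStarAlg (Fin N × Fin N)) :
      FreeStarAlg.eval (fun p : Fin N × Fin N => u p.1 p.2)
        ((∑ k, g k) - if i = j then 1 else 0) = 0 ↔
      ∑ k, FreeStarAlg.eval (fun p : Fin N × Fin N => u p.1 p.2) (g k) =
        if i = j then 1 else 0 := by
    rw [map_sub, map_sum, sub_eq_zero, apply_ite (FreeStarAlg.eval _), map_one, map_zero]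
  constructor
  · refine fun H => ⟨fun i j => ?_, fun i j => ?_⟩
    · simpa using (h i j _).1 (H _ (Or.inl ⟨i, j, rfl⟩))
    · simpa using (h i j _).1 (H _ (Or.inr ⟨i, j, rfl⟩))
  · rintro ⟨h1, h2⟩ r (⟨i, j, rfl⟩ | ⟨i, j, rfl⟩)
    · exact (h i j _).2 (by simpa using h1 i j)
    · exact (h i j _).2 (by simpa using h2 i j)

theorem UniversalCStar.isOrthogonalMatrix_gen {R : Set (FreeStarAlg (Fin N × Fin N))}
    (hR : FreeStarAlg.Bounded R) (h : orthogonalRel N ⊆ R) :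
    IsOrthogonalMatrix fun i j => UniversalCStar.gen R hR (i, j) := by
  have key (i j : Fin N) (g : Fin N → FreeStarAlg (Fin N × Fin N))
      (hg : (∑ k, g k) - (if i = j then 1 else 0) ∈ R) :
      ∑ k, UniversalCStar.mk hR (g k) = if i = j then 1 else 0 := by
    have := UniversalCStar.mk_rel hR hg
    rwa [map_sub, map_sum, sub_eq_zero, apply_ite (UniversalCStar.mk hR), map_one, map_zero] at this
  refine ⟨fun i j => UniversalCStar.star_gen hR _, fun i j => ?_, fun i j => ?_⟩
  · simpa [UniversalCStar.mk_X] using key i j _ (h (Or.inl ⟨i, j, rfl⟩))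
  · simpa [UniversalCStar.mk_X] using key i j _ (h (Or.inr ⟨i, j, rfl⟩))

theorem HyperoctahedralInfty.isHyperoctahedralInftyMatrix :
    IsHyperoctahedralInftyMatrix (HyperoctahedralInfty.u N) where
  __ := UniversalCStar.isOrthogonalMatrix_gen (R := hyperoctahedralInftyRel N)
    (orthogonalRel_bounded Set.subset_union_left) Set.subset_union_left
  mul_mul_eq_zero a b c hac h := by
    have := UniversalCStar.mk_rel (R := hyperoctahedralInftyRel N)
      (orthogonalRel_bounded Set.subset_union_left) (Or.inr ⟨a, b, c, hac, h, rfl⟩)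
    rwa [map_mul, map_mul] at this

theorem IsOrthogonalMatrix.isQuantumSubgroup {u : Fin N → Fin N → A} (hu : IsOrthogonalMatrix u) :
    IsQuantumSubgroup u (FreeOrthogonal.u N) := by
  obtain ⟨f, hf⟩ := UniversalCStar.exists_lift (R := orthogonalRel N)
    (orthogonalRel_bounded subset_rfl) (fun p : Fin N × Fin N => u p.1 p.2)
    (fun p => hu.star_eq _ _) (FreeStarAlg.eval_orthogonalRel.2 ⟨hu.row, hu.col⟩)
  exact ⟨f, fun i j => hf (i, j)⟩

theorem IsHyperoctahedralInftyMatrix.isQuantumSubgroup {u : Fin N → Fin N → A}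
    (hu : IsHyperoctahedralInftyMatrix u) :
    IsQuantumSubgroup u (HyperoctahedralInfty.u N) := by
  obtain ⟨f, hf⟩ := UniversalCStar.exists_lift (R := hyperoctahedralInftyRel N)
    (orthogonalRel_bounded Set.subset_union_left) (fun p : Fin N × Fin N => u p.1 p.2)
    (fun p => hu.star_eq _ _) (by
      rintro r (hr | ⟨a, b, c, hac, h, rfl⟩)
      · exact FreeStarAlg.eval_orthogonalRel.2 ⟨hu.row, hu.col⟩ r hr
      · simpa using hu.mul_mul_eq_zero a b c hac h)
  exact ⟨f, fun i j => hf (i, j)⟩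

theorem IsQuantumSubgroup.isOrthogonalMatrix {u : Fin N → Fin N → A}
    (h : IsQuantumSubgroup u (FreeOrthogonal.u N)) : IsOrthogonalMatrix u := by
  obtain ⟨f, hf⟩ := h
  have hw : IsOrthogonalMatrix (FreeOrthogonal.u N) :=
    UniversalCStar.isOrthogonalMatrix_gen (R := orthogonalRel N)
      (orthogonalRel_bounded subset_rfl) subset_rfl
  refine ⟨fun i j => ?_, fun i j => ?_, fun i j => ?_⟩
  · rw [← hf, ← map_star, hw.star_eq]
  · simp_rw [← hf, ← map_mul, ← map_sum, hw.row, apply_ite f, map_one, map_zero]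
  · simp_rw [← hf, ← map_mul, ← map_sum, hw.col, apply_ite f, map_one, map_zero]

end Orthogonal

/-! ### The relations of `H_N^[∞]` -/

section Relations

variable {N : ℕ} {A : Type*} [CStarAlgebra A] {u : Fin N → Fin N → A}

namespace IsOrthogonalMatrix

theorem sum_row (hu : IsOrthogonalMatrix u) (i : Fin N) : ∑ k, u i k * u i k = 1 := by
  simpa using hu.row i i

theorem sum_col (hu : IsOrthogonalMatrix u) (i : Fin N) : ∑ k, u k i * u k i = 1 := by
  simpa using hu.col i i

/-- If `u i a * u j b * u k a = 0` for `i, j, k` distinct and the squares of the entries commute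
with the entries on the same column, then distinct entries on the same column are orthogonal. -/
theorem col_mul_eq_zero (hu : IsOrthogonalMatrix u)
    (hdist : ∀ i j k a b, i ≠ j → i ≠ k → j ≠ k → u i a * u j b * u k a = 0)
    (hcomm : ∀ i k a, u i a * u i a * u k a = u k a * (u i a * u i a))
    (hN : 3 ≤ N) {i k : Fin N} (hik : i ≠ k) (a : Fin N) : u i a * u k a = 0 := by
  -- `N ≥ 3` enters here: a third row `j` is available.
  obtain ⟨j, hj⟩ : ∃ j, j ∉ ({i, k} : Finset (Fin N)) := by
    by_contra! h
    have h1 := Finset.card_le_card (fun x _ => h x : Finset.univ ⊆ ({i, k} : Finset (Fin N)))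
    have h2 : ({i, k} : Finset (Fin N)).card ≤ 2 := Finset.card_le_two
    rw [Finset.card_univ, Fintype.card_fin] at h1
    omega
  obtain ⟨hji, hjk⟩ : j ≠ i ∧ j ≠ k := by simpa using hj
  have hs := hu.star_eq
  set p : Fin N → A := fun l => u l a * u l a with hp
  have hps (l : Fin N) : star (p l) = p l := by simp [hp, hs]
  have hcomm' (l m : Fin N) : p l * u m a = u m a * p l := hcomm l m a
  have hpp (l m : Fin N) : p l * p m = p m * p l := by
    change p l * (u m a * u m a) = u m a * u m a * p l
    rw [← mul_assoc, hcomm', mul_assoc, hcomm', mul_assoc]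
  set q : A := p i * p k with hq
  have hqs : star q = q := by rw [hq, star_mul, hps, hps, hpp]
  have hq' : q = p k * p i := hpp i k
  -- The factors of `q` commute, so it can be written to end in `u k a` or in `u i a`; whichever
  -- differs from `u l a` starts a vanishing product with three distinct rows.
  have hzero (b l : Fin N) (hl : l ≠ j) : q * u j b * u l a = 0 := by
    by_cases hli : l = i
    · subst hli
      have : q * u j b * u l a = p l * u k a * (u k a * u j b * u l a) := by
        simp only [hq, hp, mul_assoc]
      rw [this, hdist k j l a b hjk.symm hik.symm hji, mul_zero]
    · have : q * u j b * u l a = p k * u i a * (u i a * u j b * u l a) := by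
        simp only [hq', hp, mul_assoc]
      rw [this, hdist i j l a b hji.symm (Ne.symm hli) hl.symm, mul_zero]
  -- Multiply by `∑ l, p l = 1`; only `l = j` survives.
  have habsorb (b : Fin N) : q * u j b = q * u j b * p j := by
    calc q * u j b = q * u j b * ∑ l, p l := by rw [hu.sum_col, mul_one]
      _ = ∑ l, q * u j b * p l := Finset.mul_sum ..
      _ = q * u j b * p j := Finset.sum_eq_single j
          (fun l _ hl => by rw [hp, ← mul_assoc, hzero b l hl, zero_mul]) (by simp)
  have hqj : q * p j = 0 := by
    have h1 : u i a * u j a * u k a = 0 := hdist i j k a a hji.symm hik hjk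
    have h2 : u i a * u j a * u k a * (u k a * u j a * u i a) = p k * p j * p i := by
      calc _ = u i a * (u j a * (p k * u j a)) * u i a := by simp only [hp, mul_assoc]
        _ = u i a * (u j a * u j a * p k) * u i a := by rw [hcomm' k j, ← mul_assoc (u j a)]
        _ = u i a * p j * (p k * u i a) := by simp only [hp, mul_assoc]
        _ = u i a * p j * u i a * p k := by rw [hcomm' k i, ← mul_assoc]
        _ = p j * u i a * u i a * p k := by rw [hcomm' j i]
        _ = p j * (p i * p k) := by simp only [hp, mul_assoc]
        _ = p j * p k * p i := by rw [hpp i k, ← mul_assoc]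
        _ = p k * p j * p i := by rw [hpp j k]
    rw [h1, zero_mul] at h2
    rw [hq', mul_assoc, hpp i j, ← mul_assoc, ← h2]
  -- For `b ≠ a`, absorption says `q * u j b * (1 - p j) = 0`, where `1 - p j` is the sum of the `u
  -- j c ^ 2` over `c ≠ a`. Positivity kills each `q * u j b * u j c`, in particular for `c = b`.
  have hqb (b : Fin N) : q * (u j b * u j b) = 0 := by
    by_cases hba : b = a
    · subst hba; exact hqj
    · have h1 : ∑ c ∈ Finset.univ.erase a, q * u j b * u j c * star (q * u j b * u j c) = 0 := by
        have h2 : ∑ c ∈ Finset.univ.erase a, u j c * u j c = 1 - p j := by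
          rw [eq_sub_iff_add_eq, Finset.sum_erase_add _ _ (Finset.mem_univ a), hu.sum_row]
        calc _ = q * u j b * (∑ c ∈ Finset.univ.erase a, u j c * u j c) * (u j b * q) := by
              rw [Finset.mul_sum, Finset.sum_mul]
              refine Finset.sum_congr rfl fun c _ => ?_
              simp only [star_mul, hs, hqs, mul_assoc]
          _ = 0 := by rw [h2, mul_sub, mul_one, ← habsorb, sub_self, zero_mul]
      rw [← mul_assoc]
      exact eq_zero_of_sum_mul_star_eq_zero h1 (Finset.mem_erase.2 ⟨hba, Finset.mem_univ b⟩)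
  have hq0 : q = 0 := by
    rw [← mul_one q, ← hu.sum_row j, Finset.mul_sum]
    exact Finset.sum_eq_zero fun b _ => hqb b
  -- Since `p k` commutes with `u i a`, the element `q` is `y * star y` for `y = u i a * u k a`.
  rw [← CStarRing.mul_star_self_eq_zero_iff, star_mul, hs, hs]
  calc u i a * u k a * (u k a * u i a) = u i a * (p k * u i a) := by simp only [hp, mul_assoc]
    _ = q := by rw [hcomm' k i, ← mul_assoc]
    _ = 0 := hq0

/-- Orthogonality within columns gives `u i a ^ 3 = u i a`, hence orthogonality within rows. The two
together cover the coinciding indices left out by `hdist`. -/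
theorem isHyperoctahedralInftyMatrix (hu : IsOrthogonalMatrix u)
    (hdist : ∀ i j k a b, i ≠ j → i ≠ k → j ≠ k → u i a * u j b * u k a = 0)
    (hcomm : ∀ i k a, u i a * u i a * u k a = u k a * (u i a * u i a))
    (hN : 3 ≤ N) : IsHyperoctahedralInftyMatrix u := by
  have hcol {i k : Fin N} (hik : i ≠ k) (a : Fin N) : u i a * u k a = 0 :=
    hu.col_mul_eq_zero hdist hcomm hN hik a
  have hcube (i a : Fin N) : u i a * (u i a * u i a) = u i a := by
    calc _ = ∑ k, u i a * (u k a * u k a) := (Finset.sum_eq_single i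
          (fun k _ hk => by rw [← mul_assoc, hcol hk.symm, zero_mul]) (by simp)).symm
      _ = u i a := by rw [← Finset.mul_sum, hu.sum_col, mul_one]
  have hrow {a c : Fin N} (hac : a ≠ c) (i : Fin N) : u i a * u i c = 0 := by
    have h : ∑ c ∈ Finset.univ.erase a, u i a * u i c * star (u i a * u i c) = 0 := by
      have h2 : ∑ c ∈ Finset.univ.erase a, u i c * u i c = 1 - u i a * u i a := by
        rw [eq_sub_iff_add_eq, Finset.sum_erase_add _ _ (Finset.mem_univ a), hu.sum_row]
      calc _ = u i a * (∑ c ∈ Finset.univ.erase a, u i c * u i c) * u i a := by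
            rw [Finset.mul_sum, Finset.sum_mul]
            refine Finset.sum_congr rfl fun c _ => ?_
            simp only [star_mul, hu.star_eq, mul_assoc]
        _ = 0 := by rw [h2, mul_sub, hcube, mul_one, sub_self, zero_mul]
    exact eq_zero_of_sum_mul_star_eq_zero h (Finset.mem_erase.2 ⟨hac.symm, Finset.mem_univ c⟩)
  have hcol3 {i k : Fin N} (hik : i ≠ k) (j a b : Fin N) : u i a * u j b * u k a = 0 := by
    by_cases hij : i = j
    · subst hij
      by_cases hab : a = b
      · subst hab; rw [mul_assoc, hcol hik, mul_zero]
      · rw [hrow hab, zero_mul]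
    by_cases hjk : j = k
    · subst hjk
      by_cases hab : a = b
      · subst hab; rw [hcol hik, zero_mul]
      · rw [mul_assoc, hrow (Ne.symm hab), mul_zero]
    exact hdist i j k a b hij hik hjk
  refine { hu with mul_mul_eq_zero := ?_ }
  rintro ⟨i, a⟩ ⟨j, b⟩ ⟨k, c⟩ hne (h | h)
  · obtain rfl : i = k := h
    have hac : a ≠ c := fun h => hne (by rw [h])
    change u i a * u j b * u i c = 0
    -- Inserting column `a` reduces the row relation to the column relation (`k ≠ i`) and to row
    -- orthogonality (`k = i`).
    calc _ = u i a * u j b * (∑ k, u k a * u k a) * u i c := by rw [hu.sum_col, mul_one]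
      _ = ∑ k, u i a * u j b * u k a * (u k a * u i c) := by
        rw [Finset.mul_sum, Finset.sum_mul]
        exact Finset.sum_congr rfl fun k _ => by simp only [mul_assoc]
      _ = 0 := Finset.sum_eq_zero fun k _ => by
        by_cases hk : i = k
        · subst hk; rw [hrow hac, mul_zero]
        · rw [hcol3 hk, zero_mul]
  · obtain rfl : a = c := h
    exact hcol3 (fun h : i = k => hne (by rw [h])) j a b

end IsOrthogonalMatrix

namespace IsHyperoctahedralInftyMatrix

theorem row_mul_mul (hu : IsHyperoctahedralInftyMatrix u) (i j b : Fin N) {a c : Fin N}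
    (hac : a ≠ c) : u i a * u j b * u i c = 0 :=
  hu.mul_mul_eq_zero (i, a) (j, b) (i, c) (by simp [hac]) (Or.inl rfl)

theorem col_mul_mul (hu : IsHyperoctahedralInftyMatrix u) (a j b : Fin N) {i k : Fin N}
    (hik : i ≠ k) : u i a * u j b * u k a = 0 :=
  hu.mul_mul_eq_zero (i, a) (j, b) (k, a) (by simp [hik]) (Or.inr rfl)

theorem col_mul (hu : IsHyperoctahedralInftyMatrix u) (a : Fin N) {i k : Fin N} (hik : i ≠ k) :
    u i a * u k a = 0 := by
  calc u i a * u k a = u i a * (∑ l, u l a * u l a) * u k a := by rw [hu.sum_col, mul_one]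
    _ = ∑ l, u i a * u l a * u l a * u k a := by
      rw [Finset.mul_sum, Finset.sum_mul]
      exact Finset.sum_congr rfl fun l _ => by simp only [mul_assoc]
    _ = 0 := Finset.sum_eq_zero fun l _ => by
      by_cases hl : i = l
      · subst hl
        rw [mul_assoc (u i a), mul_assoc (u i a), hu.col_mul_mul a i a hik, mul_zero]
      · rw [hu.col_mul_mul a l a hl, zero_mul]

/-- Multiplying by `∑ b, u i b ^ 2 = 1` on the right of one side and on the left of the other leaves
only `b = a`, so both sides equal `u i a ^ 2 * u k c * u i a ^ 2`. -/
theorem commute_sq (hu : IsHyperoctahedralInftyMatrix u) (i a k c : Fin N) :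
    u i a * u i a * u k c = u k c * (u i a * u i a) := by
  have h1 : u i a * u i a * u k c * (∑ b, u i b * u i b) =
      u i a * u i a * u k c * (u i a * u i a) := by
    rw [Finset.mul_sum]
    refine Finset.sum_eq_single a (fun b _ hb => ?_) (by simp)
    rw [mul_assoc (u i a), mul_assoc (u i a), ← mul_assoc _ (u i b), hu.row_mul_mul i k c hb.symm,
      zero_mul, mul_zero]
  have h2 : (∑ b, u i b * u i b) * (u k c * (u i a * u i a)) =
      u i a * u i a * (u k c * (u i a * u i a)) := by
    rw [Finset.sum_mul]
    refine Finset.sum_eq_single a (fun b _ hb => ?_) (by simp)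
    rw [mul_assoc (u i b), ← mul_assoc (u k c), ← mul_assoc (u i b) (u k c * u i a),
      ← mul_assoc (u i b) (u k c), hu.row_mul_mul i k c hb, zero_mul, mul_zero]
  rw [hu.sum_row, mul_one] at h1
  rw [hu.sum_row, one_mul] at h2
  rw [h1, h2, mul_assoc _ (u k c)]

end IsHyperoctahedralInftyMatrix

end Relations

/-! ### Products of sums of elementary tensors -/

section TensorSums

variable {N : ℕ} {A : Type v} {B : Type w} [CStarAlgebra A] [CStarAlgebra B]

theorem sum_tmul_mul (a a' : Fin N → A) (b b' : Fin N → B) :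
    (∑ m, a m ⊗ₜ[ℂ] b m) * (∑ m, a' m ⊗ₜ[ℂ] b' m) =
      ∑ m, ∑ n, (a m * a' n) ⊗ₜ[ℂ] (b m * b' n) := by
  simp_rw [Finset.sum_mul_sum, Algebra.TensorProduct.tmul_mul_tmul]

theorem sum_tmul_mul_mul (a a' a'' : Fin N → A) (b b' b'' : Fin N → B) :
    (∑ m, a m ⊗ₜ[ℂ] b m) * (∑ m, a' m ⊗ₜ[ℂ] b' m) * (∑ m, a'' m ⊗ₜ[ℂ] b'' m) =
      ∑ m, ∑ n, ∑ l, (a m * a' n * a'' l) ⊗ₜ[ℂ] (b m * b' n * b'' l) := by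
  simp_rw [sum_tmul_mul, Finset.sum_mul, Finset.mul_sum, Algebra.TensorProduct.tmul_mul_tmul]

theorem SpatialTensor.star_mk_sum {a : Fin N → A} {b : Fin N → B} (ha : ∀ m, star (a m) = a m)
    (hb : ∀ m, star (b m) = b m) :
    star (mk A B (∑ m, a m ⊗ₜ[ℂ] b m)) = mk A B (∑ m, a m ⊗ₜ[ℂ] b m) := by
  rw [← SpatialTensor.mk_star, star_sum]
  simp [TensorProduct.star_tmul, ha, hb]

end TensorSums

/-! ### `H_N^[∞]` is a closed subgroup of `O_N⁺` -/

section QuantumGroup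

variable {N : ℕ}

/-- The product `∑ k, u i k ⊗ v k j` of two matrices satisfying the relations of `H_N^[∞]`
satisfies them. -/
theorem IsHyperoctahedralInftyMatrix.comul {A : Type v} {B : Type w} [CStarAlgebra A]
    [CStarAlgebra B] {u : Fin N → Fin N → A} {v : Fin N → Fin N → B}
    (hu : IsHyperoctahedralInftyMatrix u) (hv : IsHyperoctahedralInftyMatrix v) :
    IsHyperoctahedralInftyMatrix fun i j => SpatialTensor.mk A B (∑ k, u i k ⊗ₜ v k j) where
  star_eq i j := SpatialTensor.star_mk_sum (hu.star_eq i) fun m => hv.star_eq m j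
  row i j := by
    have : ∑ k, (∑ m, u i m ⊗ₜ[ℂ] v m k) * (∑ m, u j m ⊗ₜ[ℂ] v m k) =
        if i = j then 1 else 0 := by
      calc _ = ∑ m, ∑ n, (u i m * u j n) ⊗ₜ[ℂ] (∑ k, v m k * v n k) := by
            simp_rw [sum_tmul_mul, TensorProduct.tmul_sum]
            rw [Finset.sum_comm]
            exact Finset.sum_congr rfl fun m _ => Finset.sum_comm
        _ = ∑ m, (u i m * u j m) ⊗ₜ[ℂ] 1 := by
            refine Finset.sum_congr rfl fun m _ => ?_
            simp_rw [hv.row]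
            refine (Finset.sum_eq_single m (fun n _ hn => ?_) (by simp)).trans (by simp)
            rw [if_neg hn.symm, TensorProduct.tmul_zero]
        _ = _ := by
            rw [← TensorProduct.sum_tmul, hu.row]
            split_ifs <;> simp [Algebra.TensorProduct.one_def]
    simp_rw [← map_mul, ← map_sum, this, apply_ite (SpatialTensor.mk A B), map_one, map_zero]
  col i j := by
    have : ∑ k, (∑ m, u k m ⊗ₜ[ℂ] v m i) * (∑ m, u k m ⊗ₜ[ℂ] v m j) =
        if i = j then 1 else 0 := by
      calc _ = ∑ m, ∑ n, (∑ k, u k m * u k n) ⊗ₜ[ℂ] (v m i * v n j) := by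
            simp_rw [sum_tmul_mul, TensorProduct.sum_tmul]
            rw [Finset.sum_comm]
            exact Finset.sum_congr rfl fun m _ => Finset.sum_comm
        _ = ∑ m, 1 ⊗ₜ[ℂ] (v m i * v m j) := by
            refine Finset.sum_congr rfl fun m _ => ?_
            simp_rw [hu.col]
            refine (Finset.sum_eq_single m (fun n _ hn => ?_) (by simp)).trans (by simp)
            rw [if_neg hn.symm, TensorProduct.zero_tmul]
        _ = _ := by
            rw [← TensorProduct.tmul_sum, hv.col]
            split_ifs <;> simp [Algebra.TensorProduct.one_def]
    simp_rw [← map_mul, ← map_sum, this, apply_ite (SpatialTensor.mk A B), map_one, map_zero]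
  mul_mul_eq_zero := by
    rintro ⟨i, a⟩ ⟨j, b⟩ ⟨k, c⟩ hne h
    simp only [← map_mul, sum_tmul_mul_mul]
    rw [Finset.sum_eq_zero, map_zero]
    refine fun m _ => Finset.sum_eq_zero fun n _ => Finset.sum_eq_zero fun l _ => ?_
    -- Either the outer indices `m, l` agree and one factor's relation applies, or they differ and
    -- the other factor's does.
    rcases h with h | h
    · obtain rfl : i = k := h
      have hac : a ≠ c := fun h : a = c => hne (by rw [h])
      by_cases hml : m = l
      · subst hml; rw [hv.row_mul_mul m n b hac, TensorProduct.tmul_zero]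
      · rw [hu.row_mul_mul i j n hml, TensorProduct.zero_tmul]
    · obtain rfl : a = c := h
      have hik : i ≠ k := fun h : i = k => hne (by rw [h])
      by_cases hml : m = l
      · subst hml; rw [hu.col_mul_mul m j n hik, TensorProduct.zero_tmul]
      · rw [hv.col_mul_mul a n b hml, TensorProduct.tmul_zero]

/-- The transpose of a matrix satisfying the relations of `H_N^[∞]` satisfies them in the opposite
algebra. -/
theorem IsHyperoctahedralInftyMatrix.op_transpose {A : Type v} [CStarAlgebra A]
    {u : Fin N → Fin N → A} (hu : IsHyperoctahedralInftyMatrix u) :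
    IsHyperoctahedralInftyMatrix fun i j => MulOpposite.op (u j i) where
  star_eq i j := by rw [← MulOpposite.op_star, hu.star_eq]
  row i j := by
    simp_rw [← MulOpposite.op_mul, ← Finset.op_sum, hu.col, eq_comm (a := j)]
    split_ifs <;> simp
  col i j := by
    simp_rw [← MulOpposite.op_mul, ← Finset.op_sum, hu.row, eq_comm (a := j)]
    split_ifs <;> simp
  mul_mul_eq_zero a b c hac h := by
    have := hu.mul_mul_eq_zero c.swap b.swap a.swap (fun h => hac (Prod.swap_injective h).symm)
      (h.symm.imp Eq.symm Eq.symm)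
    rw [← MulOpposite.op_mul, ← MulOpposite.op_mul, ← mul_assoc]
    exact congrArg MulOpposite.op this

/-- The antipode is the morphism into the opposite algebra given by `op_transpose`. It preserves
`star` and is an involution on the coefficient algebra, whence the condition on `κ (star (κ (star
a)))`. -/
theorem HyperoctahedralInfty.exists_antipode (N : ℕ) :
    ∃ κ : coeffAlg (HyperoctahedralInfty.u N) →ₗ[ℂ] coeffAlg (HyperoctahedralInfty.u N),
      (∀ a b, κ (a * b) = κ b * κ a) ∧ (∀ a, κ (star (κ (star a))) = a) ∧
      ∀ i j, κ (coeffAlg.entry (HyperoctahedralInfty.u N) i j) =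
        coeffAlg.entry (HyperoctahedralInfty.u N) j i := by
  let u := HyperoctahedralInfty.u N
  have hu : IsHyperoctahedralInftyMatrix u := HyperoctahedralInfty.isHyperoctahedralInftyMatrix
  obtain ⟨f, hf⟩ : ∃ f : HyperoctahedralInfty N →⋆ₐ[ℂ] (HyperoctahedralInfty N)ᵐᵒᵖ,
      ∀ i j, f (u i j) = MulOpposite.op (u j i) := hu.op_transpose.isQuantumSubgroup
  have hmem (a : HyperoctahedralInfty N) (ha : a ∈ coeffAlg u) : (f a).unop ∈ coeffAlg u := by
    induction ha using StarAlgebra.adjoin_induction with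
    | mem x hx =>
      obtain ⟨⟨i, j⟩, rfl⟩ := hx
      rw [hf]
      exact StarAlgebra.subset_adjoin ℂ _ ⟨(j, i), rfl⟩
    | algebraMap c => rw [AlgHomClass.commutes]; exact algebraMap_mem _ c
    | add x y _ _ hx hy => rw [map_add]; exact add_mem hx hy
    | mul x y _ _ hx hy => rw [map_mul]; exact mul_mem hy hx
    | star x _ hx => rw [map_star]; exact star_mem hx
  have hinv (a : HyperoctahedralInfty N) (ha : a ∈ coeffAlg u) : (f (f a).unop).unop = a := by
    induction ha using StarAlgebra.adjoin_induction with
    | mem x hx =>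
      obtain ⟨⟨i, j⟩, rfl⟩ := hx
      rw [hf, MulOpposite.unop_op, hf, MulOpposite.unop_op]
    | algebraMap c => simp [AlgHomClass.commutes]
    | add x y _ _ hx hy => simp [hx, hy]
    | mul x y _ _ hx hy => simp [hx, hy]
    | star x _ hx => simp [map_star, hx]
  refine ⟨{ toFun := fun a => ⟨(f a).unop, hmem a a.2⟩
            map_add' := fun a b => Subtype.ext (by simp)
            map_smul' := fun c a => Subtype.ext (by simp) }, fun a b => Subtype.ext ?_,
    fun a => Subtype.ext ?_, fun i j => Subtype.ext ?_⟩
  · simp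
  · simpa [map_star] using hinv a a.2
  · change (f (u i j)).unop = u j i
    rw [hf, MulOpposite.unop_op]

theorem HyperoctahedralInfty.isClosedSubgroupOfFreeOrthogonal (N : ℕ) :
    IsClosedSubgroupOfFreeOrthogonal (HyperoctahedralInfty.u N) := by
  have hu : IsHyperoctahedralInftyMatrix (HyperoctahedralInfty.u N) :=
    HyperoctahedralInfty.isHyperoctahedralInftyMatrix
  refine ⟨⟨UniversalCStar.dense_adjoin_gen _, ?_, ?_⟩, hu.toIsOrthogonalMatrix.isQuantumSubgroup⟩
  · obtain ⟨Δ, hΔ⟩ := (hu.comul hu).isQuantumSubgroup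
    exact ⟨Δ, fun i j => (hΔ i j).trans (map_sum (SpatialTensor.mk _ _) _ _)⟩
  · obtain ⟨κ, h1, h2, h3⟩ := HyperoctahedralInfty.exists_antipode N
    refine ⟨κ, h1, h2, fun i j => ?_, fun i j => ?_⟩
    · simp_rw [h3]
      refine Subtype.ext ?_
      rw [AddSubmonoidClass.coe_finsetSum]
      refine (hu.col i j).trans ?_
      split_ifs <;> rfl
    · simp_rw [h3]
      refine Subtype.ext ?_
      rw [AddSubmonoidClass.coe_finsetSum]
      refine (hu.row i j).trans ?_
      split_ifs <;> rfl

end QuantumGroup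

/-! ### Polygonal half-liberated spheres -/

section Sphere

variable {N : ℕ}

/-- Self-adjoint elements satisfying the relations of the polygonal half-liberated sphere. -/
structure IsPolygonalHalfSphere {B : Type*} [CStarAlgebra B] (x : Fin N → B) : Prop where
  star_eq : ∀ i, star (x i) = x i
  sum_sq : ∑ i, x i * x i = 1
  half_comm : ∀ i j k, x i * x j * x k = x k * x j * x i
  polygonal : ∀ i j k, i ≠ j → i ≠ k → j ≠ k → x i * x j * x k = 0

theorem PolygonalHalfSphere.isPolygonalHalfSphere (N : ℕ) :
    IsPolygonalHalfSphere (PolygonalHalfSphere.x N) := by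
  have hR : FreeStarAlg.Bounded (polygonalHalfSphereRel N) :=
    sphereRel_bounded Set.subset_union_left
  refine ⟨fun i => UniversalCStar.star_gen hR i, ?_, fun i j k => ?_, fun i j k hij hik hjk => ?_⟩
  · have := UniversalCStar.mk_rel hR (Or.inl rfl)
    rw [map_sub, map_sum, map_one, sub_eq_zero] at this
    simp only [map_mul] at this
    exact this
  · have := UniversalCStar.mk_rel hR (Or.inr (Or.inl ⟨i, j, k, rfl⟩))
    rw [map_sub, sub_eq_zero] at this
    simp only [map_mul] at this
    exact this
  · have := UniversalCStar.mk_rel hR (Or.inr (Or.inr ⟨i, j, k, hij, hik, hjk, rfl⟩))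
    simp only [map_mul] at this
    exact this

theorem IsPolygonalHalfSphere.exists_lift {B : Type*} [CStarAlgebra B] {x : Fin N → B}
    (hx : IsPolygonalHalfSphere x) :
    ∃ f : PolygonalHalfSphere N →⋆ₐ[ℂ] B, ∀ i, f (PolygonalHalfSphere.x N i) = x i := by
  refine UniversalCStar.exists_lift (R := polygonalHalfSphereRel N)
    (sphereRel_bounded Set.subset_union_left) x hx.star_eq ?_
  rintro r (rfl | ⟨i, j, k, rfl⟩ | ⟨i, j, k, hij, hik, hjk, rfl⟩)
  · simp [hx.sum_sq]
  · simp [hx.half_comm i j k]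
  · simp [hx.polygonal i j k hij hik hjk]

theorem IsPolygonalHalfSphere.map {B C : Type*} [CStarAlgebra B] [CStarAlgebra C] {x : Fin N → B}
    (hx : IsPolygonalHalfSphere x) (f : B →⋆ₐ[ℂ] C) : IsPolygonalHalfSphere fun i => f (x i) where
  star_eq i := by rw [← map_star, hx.star_eq]
  sum_sq := by simp_rw [← map_mul, ← map_sum, hx.sum_sq, map_one]
  half_comm i j k := by simp_rw [← map_mul, hx.half_comm i j k]
  polygonal i j k hij hik hjk := by
    simp_rw [← map_mul, hx.polygonal i j k hij hik hjk, map_zero]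

/-- Matrices satisfying the relations of `H_N^[∞]` act on polygonal half-liberated spheres. -/
theorem IsHyperoctahedralInftyMatrix.act {A : Type v} {B : Type w} [CStarAlgebra A]
    [CStarAlgebra B] {u : Fin N → Fin N → A} {x : Fin N → B}
    (hu : IsHyperoctahedralInftyMatrix u) (hx : IsPolygonalHalfSphere x) :
    IsPolygonalHalfSphere fun i => SpatialTensor.mk A B (∑ j, u i j ⊗ₜ x j) where
  star_eq i := SpatialTensor.star_mk_sum (hu.star_eq i) hx.star_eq
  sum_sq := by
    have : ∑ i, (∑ j, u i j ⊗ₜ[ℂ] x j) * (∑ j, u i j ⊗ₜ[ℂ] x j) = 1 := by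
      calc _ = ∑ m, ∑ n, (∑ i, u i m * u i n) ⊗ₜ[ℂ] (x m * x n) := by
            simp_rw [sum_tmul_mul, TensorProduct.sum_tmul]
            rw [Finset.sum_comm]
            exact Finset.sum_congr rfl fun m _ => Finset.sum_comm
        _ = ∑ m, 1 ⊗ₜ[ℂ] (x m * x m) := by
            refine Finset.sum_congr rfl fun m _ => ?_
            simp_rw [hu.col]
            refine (Finset.sum_eq_single m (fun n _ hn => ?_) (by simp)).trans (by simp)
            rw [if_neg hn.symm, TensorProduct.zero_tmul]
        _ = 1 := by rw [← TensorProduct.tmul_sum, hx.sum_sq, Algebra.TensorProduct.one_def]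
    simp_rw [← map_mul, ← map_sum, this, map_one]
  half_comm i j k := by
    simp only [← map_mul, sum_tmul_mul_mul]
    congr 1
    -- Half-commutation of the `x`'s exchanges the outer summation indices, so both sides can be
    -- compared term by term over the same monomial.
    have hswap : ∑ m, ∑ n, ∑ l, (u k m * u j n * u i l) ⊗ₜ[ℂ] (x m * x n * x l) =
        ∑ m, ∑ n, ∑ l, (u k l * u j n * u i m) ⊗ₜ[ℂ] (x m * x n * x l) := by
      calc _ = ∑ n, ∑ m, ∑ l, (u k m * u j n * u i l) ⊗ₜ[ℂ] (x m * x n * x l) := Finset.sum_comm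
        _ = ∑ n, ∑ l, ∑ m, (u k m * u j n * u i l) ⊗ₜ[ℂ] (x m * x n * x l) :=
            Finset.sum_congr rfl fun n _ => Finset.sum_comm
        _ = ∑ l, ∑ n, ∑ m, (u k m * u j n * u i l) ⊗ₜ[ℂ] (x m * x n * x l) := Finset.sum_comm
        _ = _ := by simp_rw [hx.half_comm]
    rw [hswap]
    refine Finset.sum_congr rfl fun a _ => Finset.sum_congr rfl fun b _ =>
      Finset.sum_congr rfl fun c _ => ?_
    by_cases hik : i = k
    · subst hik
      by_cases hac : a = c
      · rw [hac]
      · rw [hu.row_mul_mul i j b hac, hu.row_mul_mul i j b (Ne.symm hac)]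
    by_cases hac : a = c
    · subst hac
      rw [hu.col_mul_mul a j b hik, hu.col_mul_mul a j b (Ne.symm hik)]
    -- With `i ≠ k` and `a ≠ c`, a coincidence of neighbouring columns reduces to `commute_sq` or to
    -- column orthogonality; without one, the monomial in `x` vanishes.
    by_cases hab : a = b
    · subst hab
      by_cases hij : i = j
      · subst hij; rw [hu.commute_sq, mul_assoc (u k c)]
      · rw [hu.col_mul a hij, mul_assoc (u k c), hu.col_mul a (Ne.symm hij), zero_mul, mul_zero]
    by_cases hbc : b = c
    · subst hbc
      by_cases hjk : j = k
      · subst hjk; rw [hu.commute_sq, mul_assoc (u i a)]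
      · rw [hu.col_mul b (Ne.symm hjk), mul_assoc (u i a), hu.col_mul b hjk, zero_mul, mul_zero]
    rw [hx.polygonal a b c hab hac hbc, TensorProduct.tmul_zero, TensorProduct.tmul_zero]
  polygonal i j k hij hik hjk := by
    simp only [← map_mul, sum_tmul_mul_mul]
    rw [Finset.sum_eq_zero, map_zero]
    refine fun a _ => Finset.sum_eq_zero fun b _ => Finset.sum_eq_zero fun c _ => ?_
    by_cases hab : a = b
    · subst hab; rw [hu.col_mul a hij, zero_mul, TensorProduct.zero_tmul]
    by_cases hbc : b = c
    · subst hbc; rw [mul_assoc, hu.col_mul b hjk, mul_zero, TensorProduct.zero_tmul]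
    by_cases hac : a = c
    · subst hac; rw [hu.col_mul_mul a j b hik, TensorProduct.zero_tmul]
    rw [hx.polygonal a b c hab hac hbc, TensorProduct.tmul_zero]

theorem HyperoctahedralInfty.actsAffinely (N : ℕ) :
    ActsAffinely (HyperoctahedralInfty.u N) (PolygonalHalfSphere.x N) := by
  obtain ⟨Φ, hΦ⟩ := (HyperoctahedralInfty.isHyperoctahedralInftyMatrix.act
    (PolygonalHalfSphere.isPolygonalHalfSphere N)).exists_lift
  exact ⟨Φ, fun i => by rw [hΦ, map_sum]; rfl⟩

end Sphere

/-! ### Independence of cubic monomials on the polygonal half-liberated sphere -/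

section Models

variable {N : ℕ}

/-- The self-adjoint matrix with off-diagonal entries `c` and `conj c`. -/
noncomputable def antidiag (c : ℂ) : Matrix (Fin 2) (Fin 2) ℂ := !![0, c; star c, 0]

theorem antidiag_mul (c d : ℂ) : antidiag c * antidiag d = !![c * star d, 0; 0, star c * d] := by
  simp [antidiag]

/-- Only the middle entry is conjugated, so the outer two may be exchanged: this is why antidiagonal
matrices half-commute. -/
theorem antidiag_mul_mul (c d e : ℂ) :
    antidiag c * antidiag d * antidiag e = antidiag (c * star d * e) := by
  rw [antidiag_mul]
  simp [antidiag]

/-- A point `c` of the complex sphere with at most two non-zero coordinates gives a representation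
of the polygonal half-liberated sphere by `2 × 2` matrices. -/
theorem PolygonalHalfSphere.exists_representation (c : Fin N → ℂ) (h1 : ∑ i, c i * star (c i) = 1)
    (h2 : ∀ i j k, i ≠ j → i ≠ k → j ≠ k → c i * star (c j) * c k = 0) :
    ∃ (ρ : PolygonalHalfSphere N →⋆ₐ[ℂ]
        (EuclideanSpace ℂ (Fin 2) →L[ℂ] EuclideanSpace ℂ (Fin 2))),
      ∀ i, ρ (PolygonalHalfSphere.x N i) = Matrix.toEuclideanCLM (𝕜 := ℂ) (antidiag (c i)) := by
  refine IsPolygonalHalfSphere.exists_lift ⟨fun i => ?_, ?_, fun i j k => ?_,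
    fun i j k hij hik hjk => ?_⟩
  · rw [← map_star]
    congr 1
    ext a b
    fin_cases a <;> fin_cases b <;> simp [antidiag, Matrix.star_apply]
  · have h (d : ℂ) : antidiag d * antidiag d = (d * star d) • 1 := by
      ext a b
      rw [antidiag_mul]
      fin_cases a <;> fin_cases b <;> simp [mul_comm]
    simp_rw [← map_mul, ← map_sum, h, ← Finset.sum_smul, h1, one_smul, map_one]
  · simp_rw [← map_mul, antidiag_mul_mul]
    rw [mul_right_comm, mul_right_comm (c k), mul_comm (c i)]
  · simp_rw [← map_mul, antidiag_mul_mul, h2 i j k hij hik hjk]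
    rw [← map_zero (Matrix.toEuclideanCLM (n := Fin 2) (𝕜 := ℂ))]
    congr 1
    ext a b
    fin_cases a <;> fin_cases b <;> simp [antidiag]

/-- Slicing by a matrix coefficient of the antidiagonal model at `c` turns the tensor identity into
a polynomial identity in `c` and its conjugate. -/
theorem SpatialTensor.sum_smul_eq_zero {A : Type v} [CStarAlgebra A]
    {T : Fin N → Fin N → Fin N → A}
    (hT : mk A (PolygonalHalfSphere N) (∑ m, ∑ n, ∑ l, T m n l ⊗ₜ (PolygonalHalfSphere.x N m *
      PolygonalHalfSphere.x N n * PolygonalHalfSphere.x N l)) = 0)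
    (c : Fin N → ℂ) (h1 : ∑ i, c i * star (c i) = 1)
    (h2 : ∀ i j k, i ≠ j → i ≠ k → j ≠ k → c i * star (c j) * c k = 0) :
    ∑ m, c m • ∑ n, star (c n) • ∑ l, c l • T m n l = 0 := by
  obtain ⟨ρ, hρ⟩ := PolygonalHalfSphere.exists_representation c h1 h2
  -- These two basis vectors pick out the upper right entry.
  have hφ (m n l : Fin N) : vectorFunctional ρ (EuclideanSpace.single 1 1)
      (EuclideanSpace.single 0 1) (PolygonalHalfSphere.x N m * PolygonalHalfSphere.x N n *
        PolygonalHalfSphere.x N l) = c m * star (c n) * c l := by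
    change inner ℂ _ (ρ _ _) = _
    rw [map_mul, map_mul, hρ, hρ, hρ, ← map_mul, ← map_mul, antidiag_mul_mul,
      EuclideanSpace.inner_single_left]
    simp [antidiag, Matrix.ofLp_toEuclideanCLM, Matrix.mulVec, dotProduct]
  have := SpatialTensor.slice_eq_zero hT ρ (EuclideanSpace.single 1 1) (EuclideanSpace.single 0 1)
  simp_rw [map_sum, slice_tmul, hφ] at this
  simpa only [Finset.smul_sum, smul_smul, mul_assoc] using this

/-- The function `f` allows for the three uses: coordinates, their conjugates and their squared
moduli. -/
theorem sum_smul_single_add {E : Type*} [AddCommGroup E] [Module ℂ E] {a b : Fin N} (hab : a ≠ b)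
    {f : ℂ → ℂ} (hf : f 0 = 0) (s t : ℂ) (g : Fin N → E) :
    ∑ m, f ((Pi.single a s + Pi.single b t : Fin N → ℂ) m) • g m = f s • g a + f t • g b := by
  rw [Finset.sum_eq_add_of_mem a b (Finset.mem_univ a) (Finset.mem_univ b) hab
    (fun m _ hm => by simp [Pi.single_eq_of_ne hm.1, Pi.single_eq_of_ne hm.2, hf])]
  simp [Pi.single_eq_of_ne hab, Pi.single_eq_of_ne hab.symm]

/-- The monomials `x a * x b * x a` can be separated from the other cubic monomials. -/
theorem SpatialTensor.coeff_eq_zero {A : Type v} [CStarAlgebra A]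
    {T : Fin N → Fin N → Fin N → A}
    (hT : mk A (PolygonalHalfSphere N) (∑ m, ∑ n, ∑ l, T m n l ⊗ₜ (PolygonalHalfSphere.x N m *
      PolygonalHalfSphere.x N n * PolygonalHalfSphere.x N l)) = 0) (a b : Fin N) :
    T a b a = 0 := by
  by_cases hab : a = b
  · subst hab
    have := SpatialTensor.sum_smul_eq_zero hT (Pi.single a 1) (by simp [Pi.single_apply])
      (fun i j k hij hik hjk => by
        by_cases hi : i = a
        · subst hi; simp [Pi.single_eq_of_ne hij.symm]
        · simp [Pi.single_eq_of_ne hi])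
    simpa [Pi.single_apply] using this
  -- The point has coordinates `3/5 * ζ` and `4/5`, of norm one since 3, 4, 5 is a Pythagorean
  -- triple. Only `T a b a` carries `ζ ^ 2`.
  have key (ζ : ℂ) (hζ : ζ * star ζ = 1) :
      (27 / 125 * ζ) • T a a a + (36 / 125 : ℂ) • (T a a b + T b a a) +
        (36 / 125 * ζ ^ 2) • T a b a + (48 / 125 * ζ) • (T a b b + T b b a) +
        (48 / 125 * star ζ) • T b a b + (64 / 125 : ℂ) • T b b b = 0 := by
    have h3 := SpatialTensor.sum_smul_eq_zero hT
      (Pi.single a (3 / 5 * ζ) + Pi.single b (4 / 5)) ?_ ?_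
    · have hid := fun (g : Fin N → A) => sum_smul_single_add hab (f := id) rfl (3 / 5 * ζ) (4 / 5) g
      have hst := fun (g : Fin N → A) =>
        sum_smul_single_add hab (f := star) (star_zero ℂ) (3 / 5 * ζ) (4 / 5) g
      simp only [id] at hid
      simp_rw [hid, hst] at h3
      have e3 : star (3 / 5 * ζ) = 3 / 5 * star ζ := by simp
      have e4 : star (4 / 5 : ℂ) = 4 / 5 := by simp
      rw [e3, e4] at h3
      linear_combination (norm := module) h3 - (27 / 125 * ζ * hζ) • T a a a - (36 / 125 * hζ) • (T a a b + T b a a)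
    · have := sum_smul_single_add hab (f := fun c => c * star c) (by simp) (3 / 5 * ζ) (4 / 5)
        (fun _ => (1 : ℂ))
      simp only [smul_eq_mul, mul_one] at this
      rw [this]
      have e3 : star (3 / 5 * ζ) = 3 / 5 * star ζ := by simp
      have e4 : star (4 / 5 : ℂ) = 4 / 5 := by simp
      rw [e3, e4]
      linear_combination 9 / 25 * hζ
    · intro i j k hij hik hjk
      have hz (m : Fin N) (ha : m ≠ a) (hb : m ≠ b) :
          (Pi.single a (3 / 5 * ζ) + Pi.single b (4 / 5) : Fin N → ℂ) m = 0 := by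
        simp [Pi.single_eq_of_ne ha, Pi.single_eq_of_ne hb]
      by_cases hi : i ≠ a ∧ i ≠ b
      · rw [hz i hi.1 hi.2, zero_mul, zero_mul]
      by_cases hj : j ≠ a ∧ j ≠ b
      · rw [hz j hj.1 hj.2, star_zero, mul_zero, zero_mul]
      rw [hz k (by grind) (by grind), mul_zero]
  -- The powers of `ζ` that occur, from `-1` to `2`, are distinct mod 4, so averaging over the
  -- fourth roots of unity with weight `ζ ^ (-2)` isolates `ζ ^ 2`. The factor `125 / 144` inverts
  -- `4 * 36 / 125`.
  have k1 := key 1 (by simp)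
  have k2 := key (-1) (by simp)
  have k3 := key Complex.I (by simp)
  have k4 := key (-Complex.I) (by simp)
  simp only [Complex.I_sq, neg_sq, star_neg, star_one, one_pow, Complex.star_def,
    Complex.conj_I] at k1 k2 k3 k4
  linear_combination (norm := module) (125 / 144 : ℂ) • (k1 + k2 - k3 - k4)

end Models

/-! ### The quantum isometry group of the polygonal half-liberated sphere -/

theorem proposition5p5 (N : ℕ) (hN : 3 ≤ N) :
    IsQuantumIsometryGroup.{0, 0, z} (HyperoctahedralInfty.u N) (PolygonalHalfSphere.x N) := by
  refine ⟨HyperoctahedralInfty.isClosedSubgroupOfFreeOrthogonal N,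
    HyperoctahedralInfty.actsAffinely N, fun A _ u hG ⟨Φ, hΦ⟩ => ?_⟩
  have hX := (PolygonalHalfSphere.isPolygonalHalfSphere N).map Φ
  have hΦ' (i : Fin N) : Φ (PolygonalHalfSphere.x N i) = SpatialTensor.mk A (PolygonalHalfSphere N)
      (∑ j, u i j ⊗ₜ PolygonalHalfSphere.x N j) := by rw [hΦ, map_sum]; rfl
  refine (hG.2.isOrthogonalMatrix.isHyperoctahedralInftyMatrix
    (fun i j k a b hij hik hjk => ?_) (fun i k a => ?_) hN).isQuantumSubgroup
  · have := hX.polygonal i j k hij hik hjk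
    simp only [hΦ', ← map_mul, sum_tmul_mul_mul] at this
    exact SpatialTensor.coeff_eq_zero (T := fun a b c => u i a * u j b * u k c) this a b
  -- Only the coefficient of `x a ^ 3` in this relation is needed.
  · have := hX.half_comm i i k
    simp only [hΦ', ← map_mul, sum_tmul_mul_mul] at this
    rw [← sub_eq_zero, ← map_sub] at this
    simp only [← Finset.sum_sub_distrib, ← TensorProduct.sub_tmul] at this
    have := SpatialTensor.coeff_eq_zero
      (T := fun a b c => u i a * u i b * u k c - u k a * u i b * u i c) this a a
    rwa [sub_eq_zero, mul_assoc (u k a)] at this
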